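/- **Setting.** Fix a set $\mathcal L$ of location names. *Local language.* A local language has types $t$ and expressions $e$, with type and expression variables and the usual capture-avoiding substitutions; a set of values; a small-step relation $e\to e'$ in which values do not step and which has the diamond property ($e_1\to e_2$ and $e_1\to e_3$ imply $e_2=e_3$ or $e_2\to e_4$, $e_3\to e_4$ for some $e_4$); and judgments $\Gamma\Vdash t$ (kinding, $\Gamma$ a set of type variables) and $\Gamma;\Sigma\Vdash e:t$ (typing, $\Sigma$ a partial map from variables to types). Required of them: $\alpha\in\Gamma$ implies $\Gamma\Vdash\alpha$; if $\Gamma;\Sigma\Vdash e:t$ then $\Gamma\Vdash t$ and $\Gamma\Vdash\Sigma$ (all types in $\Sigma$ are well-kinded in $\Gamma$); if $\Gamma\Vdash\Sigma$ and $x:t\in\Sigma$ then $\Gamma;\Sigma\Vdash x:t$; and kinding and typing are preserved by simultaneous well-kinded substitution of types and well-typed substitution of expressions (this includes weakening). There are closed well-kinded types $\mathsf{bool}$, $\mathsf{loc}_A$, $\mathsf{locset}_A$ (for finite $A\subseteq\mathcal L$) and $\mathsf{tyRep}$. A value represents at most one boolean, at most one location name, at most one finite set of location names, and at most one local type. Every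 closed value of these four types represents, respectively, a boolean, a name in $A$, a subset of $A$, a type; and if $\Gamma;\Sigma\Vdash v:\mathsf{tyRep}$ and the value $v$ represents $t$, then $\Gamma\Vdash t$. *Local progress*: if $\varnothing;\varnothing\Vdash e:t$ then $e$ is a value or $e\to e'$ for some $e'$. *Local preservation*: if $\Gamma;\Sigma\Vdash e:t$ and $e\to e'$ then $\Gamma;\Sigma\Vdash e':t$. *Local values are closed* if $\Gamma;\Sigma\Vdash v:t$ with $v$ a value implies $\Gamma;\varnothing\Vdash v:t$. *Types of $\lambda$QC.* Kinds are $*$ (choreographic types), $*_e$ (local types), $*_\ell$ (locations), $*_s$ (location sets). Locations are $\ell::=\alpha\mid L$ ($L\in\mathcal L$), location sets $\rho::=\alpha\mid\varnothing\mid\{\ell\}\mid\rho\cup\rho$ (syntactic terms), and choreographic types $\tau::=\alpha\mid t@\rho\mid\tau\to\tau\mid\tau\times\tau\mid\tau+\tau\mid\forall\alpha{::}\kappa.\tau\mid\mu\alpha.\tau$. The judgment $\Gamma\vdash\cdot::\kappa$ is the evident one, where variables have the kind given by $\Gamma$ and a local type is well-kinded if it is so in the local language over the variables of kind $*_e$ in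 $\Gamma$. A finite set of names is identified with the union of its singletons. *Necessary containment* $\ell\in\rho$ is generated by $\ell\in\{\ell\}$ and closure under unions. *Possible containment* $\lozenge(\ell\in\rho)$ is generated by $\lozenge(\ell\in\alpha)$, $\lozenge(\ell\in\{\alpha\})$, $\lozenge(L\in\{L\})$ and closure under unions. Two sets are *disjoint* if no $\ell$ is possibly in both. $\rho_1\subseteq\rho_2$ is generated by $\varnothing\subseteq\rho$, $\rho\subseteq\rho$, [$\rho\subseteq\rho_1$ or $\rho\subseteq\rho_2$] $\Rightarrow\rho\subseteq\rho_1\cup\rho_2$, $\ell\in\rho\Rightarrow\{\ell\}\subseteq\rho$, and $\rho_1,\rho_2\subseteq\rho\Rightarrow\rho_1\cup\rho_2\subseteq\rho$. *Choreographies.* $C::=X\mid\rho.e\mid\mathsf{fun}\,F(X{:}\tau):=C\mid C\,C\mid\Lambda\alpha{::}\kappa.C\mid C\,t\mid\mathsf{fold}\,C\mid\mathsf{unfold}\,C\mid(C,C)\mid\mathsf{fst}\,C\mid\mathsf{snd}\,C\mid\mathsf{inl}\,C\mid\mathsf{inr}\,C\mid\mathsf{case}\,C\,(X.C_1)(Y.C_2)\mid\mathsf{let}\,\rho.x{:}t:=C_1\,\mathsf{in}\,C_2\mid\mathsf{let}\,\rho.\alpha{::}\kappa:=C_1\,\mathsf{in}\,C_2\mid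 C\rightsquigarrow_\ell\rho\mid\ell[d]\rightsquigarrow\rho;C\mid\mathsf{if}_\rho\,C\,\mathsf{then}\,C_1\,\mathsf{else}\,C_2$, with $d\in\{\mathbf L,\mathbf R\}$; in $C\,t$, $t$ is a type, location or location set. Values are $\rho.v$ ($v$ a local value), $\mathsf{fun}$, $\Lambda$, and pairs, $\mathsf{inl}$, $\mathsf{inr}$, $\mathsf{fold}$ of values. *Typing* $\Gamma;\Delta;\Sigma\vdash C:\tau$. Here $\Gamma$ assigns kinds to type variables, $\Delta$ types of kind $*$ to choreographic variables, and $\Sigma$ consists of declarations $\rho.x{:}t$ of local variables; contexts are well-formed. $\Sigma|_\rho$ keeps the declarations $\rho'.x{:}t$ with $\rho\subseteq\rho'$. The rules for variables, recursive functions, type abstraction and application, products, sums and iso-recursive types are the standard ones. The others (with all displayed location sets, locations and result types well-kinded in $\Gamma$) are: - $\rho.e:t@\rho$ if $\Gamma;\Sigma|_\rho\Vdash e:t$. - $\mathsf{let}\,\rho.x{:}t:=C_1\,\mathsf{in}\,C_2:\tau$ if $C_1:t@\rho'$, $\rho\subseteq\rho'$, and $C_2:\tau$ under $\Sigma,\rho.x{:}t$.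 - $\mathsf{let}\,\rho.\alpha{::}\kappa:=C_1\,\mathsf{in}\,C_2:\tau$ if $\rho\subseteq\rho'$, $\Gamma\vdash\tau::*$ (so $\alpha$ is not free in $\tau$), $C_2:\tau$ under $\Gamma,\alpha{::}\kappa$, and either $\kappa=*_\ell$, $C_1:\mathsf{loc}_A@\rho'$, $A\subseteq\rho$; or $\kappa=*_s$, $C_1:\mathsf{locset}_A@\rho'$, $A\subseteq\rho$; or $\kappa=*_e$, $C_1:\mathsf{tyRep}@\rho'$. - $C\rightsquigarrow_\ell\rho_2:t@(\rho_1\cup\rho_2)$ if $C:t@\rho_1$ and $\ell\in\rho_1$. - $\ell[d]\rightsquigarrow\rho;C:\tau$ if $C:\tau$. - $\mathsf{if}_\rho\,C\,\mathsf{then}\,C_1\,\mathsf{else}\,C_2:\tau$ if $C:\mathsf{bool}@\rho'$, $\rho\subseteq\rho'$, and $C_1,C_2:\tau$. *Semantics.* Steps $C\Rightarrow_R C'$ are labelled by redices $R$, which record the kind of reduction, its participants and the data used. The set $\mathrm{rloc}(R)$ of locations blocked by $R$ consists of the participants for local, let, send, selection and if steps; it is all locations for application, unfolding, projection and case steps;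 and it is unchanged by wrapping a redex in the markers recording that it acts in a function, argument, left-pair or right-pair position. The set $\mathrm{cloc}(C)$ is $\rho$ for $\rho.e$; empty for variables, functions and $\Lambda$; all locations for applications, $\mathsf{unfold}$, projections and $\mathsf{case}$; and otherwise the union of the sets for the immediate subterms and the location sets (and sender) displayed by the construct. The rules are: - call-by-value, left-to-right reduction in evaluation contexts, with the standard $\beta$-rules for functions, type abstractions, sums, products and $\mathsf{unfold}(\mathsf{fold}\,V)$; - $\rho.e\Rightarrow\rho.e'$ if $e\to e'$; - for local values $v$: $\mathsf{let}\,\rho.x{:}t:=\rho'.v\,\mathsf{in}\,C\Rightarrow C[x\mapsto v]$; $\mathsf{let}\,\rho.\alpha{::}\kappa:=\rho'.v\,\mathsf{in}\,C\Rightarrow C[\alpha\mapsto t]$ if $v$ represents the local type, location or location set $t$, according to $\kappa$; $\rho_1.v\rightsquigarrow_\ell\rho_2\Rightarrow(\rho_1\cup\rho_2).v$; $\mathsf{if}_\rho\,\rho'.v\,\mathsf{then}\,C_1\,\mathsf{else}\,C_2$ steps to $C_1$ or $C_2$ as $v$ represents true or false; - $\ell[d]\rightsquigarrow\rho;C\Rightarrow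 C$; - out-of-order steps: $R$ may be performed in the body of either let form if $\mathrm{rloc}(R)$ is disjoint from $\rho$ and $\mathrm{cloc}(C_1)$; under a selection if it is disjoint from $\{\ell\}\cup\rho$; in both branches of an $\mathsf{if}_\rho\,C$ simultaneously, with the same $R$, if it is disjoint from $\rho$ and $\mathrm{cloc}(C)$; in $C_2$ of $C_1\,C_2$ or $(C_1,C_2)$ if it is disjoint from $\mathrm{cloc}(C_1)$. **Theorem (type soundness of $\lambda$QC).** Let the local language satisfy local progress and local preservation. 1. *Preservation.* If $\Gamma;\Delta;\Sigma\vdash C:\tau$ and $C\Rightarrow_R C'$ for some redex $R$, and if $\Sigma$ is empty or local values are closed, then $\Gamma;\Delta;\Sigma\vdash C':\tau$. 2. *Progress.* If $\varnothing;\varnothing;\varnothing\vdash C:\tau$, then $C$ is a value or there are $R$ and $C'$ with $C\Rightarrow_R C'$. -/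

import Mathlib

namespace LambdaQC

universe u v w

/-- A local language over a set `Loc` of location names: types and expressions with de Bruijn
variables and parallel substitution, values, a small-step semantics, a kinding and a typing
judgment, and the types whose values represent booleans, location names, finite sets of location
names, and local types.  There is one local kind, so a kinding context is the set of type variables
in scope; a typing context is a partial map from variables to types. -/
structure LocalLang (Loc : Type u) where
  /-- local types -/
  Ty : Type v
  /-- local expressions -/
  Expr : Type w
  /-- type variables -/
  tvar : ℕ → Ty
  /-- parallel substitution in a type -/
  tySubst : (ℕ → Ty) → Ty → Ty
  tySubst_tvar : ∀ σ n, tySubst σ (tvar n) = σ n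
  tySubst_id : ∀ t, tySubst tvar t = t
  tySubst_comp : ∀ σ θ t, tySubst θ (tySubst σ t) = tySubst (fun n => tySubst θ (σ n)) t
  /-- expression variables -/
  var : ℕ → Expr
  /-- parallel substitution of expressions in an expression -/
  subst : (ℕ → Expr) → Expr → Expr
  subst_var : ∀ σ n, subst σ (var n) = σ n
  subst_id : ∀ e, subst var e = e
  subst_comp : ∀ σ θ e, subst θ (subst σ e) = subst (fun n => subst θ (σ n)) e
  /-- parallel substitution of types in an expression -/
  instTy : (ℕ → Ty) → Expr → Expr
  instTy_var : ∀ σ n, instTy σ (var n) = var n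
  instTy_id : ∀ e, instTy tvar e = e
  instTy_comp : ∀ σ θ e, instTy θ (instTy σ e) = instTy (fun n => tySubst θ (σ n)) e
  instTy_subst : ∀ σ s e, instTy σ (subst s e) = subst (fun n => instTy σ (s n)) (instTy σ e)
  /-- values -/
  IsVal : Expr → Prop
  /-- small steps -/
  Step : Expr → Expr → Prop
  val_not_step : ∀ v e, IsVal v → ¬ Step v e
  diamond : ∀ e₁ e₂ e₃, Step e₁ e₂ → Step e₁ e₃ → e₂ = e₃ ∨ ∃ e₄, Step e₂ e₄ ∧ Step e₃ e₄
  /-- `Kinded Γ t`: the type `t` is well-formed in `Γ` -/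
  Kinded : Set ℕ → Ty → Prop
  /-- `Typed Γ S e t`: the expression `e` has type `t` in `Γ; S` -/
  Typed : Set ℕ → (ℕ → Option Ty) → Expr → Ty → Prop
  kinded_tvar : ∀ Γ α, α ∈ Γ → Kinded Γ (tvar α)
  kinded_subst : ∀ Γ Γ' σ t, Kinded Γ t → (∀ α ∈ Γ, Kinded Γ' (σ α)) → Kinded Γ' (tySubst σ t)
  typed_ctx : ∀ Γ S e t, Typed Γ S e t → ∀ x s, S x = some s → Kinded Γ s
  typed_kinded : ∀ Γ S e t, Typed Γ S e t → Kinded Γ t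
  typed_var : ∀ Γ S x t, (∀ y s, S y = some s → Kinded Γ s) → S x = some t → Typed Γ S (var x) t
  typed_subst : ∀ Γ S S' σ e t, Typed Γ S e t → (∀ y s, S' y = some s → Kinded Γ s) →
    (∀ x s, S x = some s → Typed Γ S' (σ x) s) → Typed Γ S' (subst σ e) t
  typed_instTy : ∀ Γ Γ' S σ e t, Typed Γ S e t → (∀ α ∈ Γ, Kinded Γ' (σ α)) →
    Typed Γ' (fun x => (S x).map (tySubst σ)) (instTy σ e) (tySubst σ t)
  /-- the type of booleans -/
  boolTy : Ty
  /-- the type of representations of location names in the given set -/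
  locTy : Finset Loc → Ty
  /-- the type of representations of subsets of the given set -/
  locSetTy : Finset Loc → Ty
  /-- the type of representations of local types -/
  repTy : Ty
  kinded_boolTy : ∀ Γ, Kinded Γ boolTy
  kinded_locTy : ∀ Γ A, Kinded Γ (locTy A)
  kinded_locSetTy : ∀ Γ A, Kinded Γ (locSetTy A)
  kinded_repTy : ∀ Γ, Kinded Γ repTy
  subst_boolTy : ∀ σ, tySubst σ boolTy = boolTy
  subst_locTy : ∀ σ A, tySubst σ (locTy A) = locTy A
  subst_locSetTy : ∀ σ A, tySubst σ (locSetTy A) = locSetTy A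
  subst_repTy : ∀ σ, tySubst σ repTy = repTy
  /-- the boolean, location, set of locations, or type that an expression represents, if any -/
  asBool : Expr → Option Bool
  asLoc : Expr → Option Loc
  asLocSet : Expr → Option (Finset Loc)
  asTy : Expr → Option Ty
  val_bool : ∀ v, IsVal v → Typed ∅ (fun _ => none) v boolTy → ∃ b, asBool v = some b
  val_loc : ∀ v A, IsVal v → Typed ∅ (fun _ => none) v (locTy A) → ∃ L ∈ A, asLoc v = some L
  val_locSet : ∀ v A, IsVal v → Typed ∅ (fun _ => none) v (locSetTy A) →
    ∃ B ⊆ A, asLocSet v = some B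
  val_rep : ∀ v, IsVal v → Typed ∅ (fun _ => none) v repTy → ∃ t, asTy v = some t
  rep_kinded : ∀ Γ S v t, IsVal v → Typed Γ S v repTy → asTy v = some t → Kinded Γ t

/-- Local progress. -/
def LocalLang.Progress {Loc : Type u} (𝕃 : LocalLang.{u, v, w} Loc) : Prop :=
  ∀ e t, 𝕃.Typed ∅ (fun _ => none) e t → 𝕃.IsVal e ∨ ∃ e', 𝕃.Step e e'

/-- Local preservation. -/
def LocalLang.Preservation {Loc : Type u} (𝕃 : LocalLang.{u, v, w} Loc) : Prop :=
  ∀ Γ S e e' t, 𝕃.Typed Γ S e t → 𝕃.Step e e' → 𝕃.Typed Γ S e' t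

/-- Local values contain no free expression variables (as far as typing can see). -/
def LocalLang.ValuesClosed {Loc : Type u} (𝕃 : LocalLang.{u, v, w} Loc) : Prop :=
  ∀ Γ S v t, 𝕃.IsVal v → 𝕃.Typed Γ S v t → 𝕃.Typed Γ (fun _ => none) v t

/-- Kinds: choreographic types, local types, locations, location sets. -/
inductive Kind : Type
  | chor
  | lty
  | loc
  | locSet

/-- Lifting a renaming under a binder. -/
def upRen (ξ : ℕ → ℕ) : ℕ → ℕ
  | 0 => 0
  | n + 1 => ξ n + 1

/-- Choreographic types, locations and location sets.  All type variables, of whatever kind, share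
one de Bruijn index space. -/
inductive CTy {Loc : Type u} (𝕃 : LocalLang.{u, v, w} Loc) : Type (max u v)
  /-- type variable `α` -/
  | var (n : ℕ)
  /-- local type -/
  | lty (t : 𝕃.Ty)
  /-- `t @ ρ`, for a local type `t` -/
  | located (t : 𝕃.Ty) (ρ : CTy 𝕃)
  | arr (τ₁ τ₂ : CTy 𝕃)
  /-- `∀ α :: κ. τ` -/
  | all (κ : Kind) (τ : CTy 𝕃)
  | prod (τ₁ τ₂ : CTy 𝕃)
  | sum (τ₁ τ₂ : CTy 𝕃)
  /-- `μ α. τ` -/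
  | mu (τ : CTy 𝕃)
  /-- location name -/
  | loc (L : Loc)
  /-- the empty location set -/
  | empty
  /-- `{ℓ}` -/
  | sng (l : CTy 𝕃)
  | union (ρ₁ ρ₂ : CTy 𝕃)

section Calculus

variable {Loc : Type u} {𝕃 : LocalLang.{u, v, w} Loc}

namespace CTy

def rename (ξ : ℕ → ℕ) : CTy 𝕃 → CTy 𝕃
  | var n => var (ξ n)
  | lty t => lty (𝕃.tySubst (fun n => 𝕃.tvar (ξ n)) t)
  | located t ρ => located (𝕃.tySubst (fun n => 𝕃.tvar (ξ n)) t) (ρ.rename ξ)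
  | arr τ₁ τ₂ => arr (τ₁.rename ξ) (τ₂.rename ξ)
  | all κ τ => all κ (τ.rename (upRen ξ))
  | prod τ₁ τ₂ => prod (τ₁.rename ξ) (τ₂.rename ξ)
  | sum τ₁ τ₂ => sum (τ₁.rename ξ) (τ₂.rename ξ)
  | mu τ => mu (τ.rename (upRen ξ))
  | loc L => loc L
  | empty => empty
  | sng l => sng (l.rename ξ)
  | union ρ₁ ρ₂ => union (ρ₁.rename ξ) (ρ₂.rename ξ)

/-- Weakening by one type variable. -/
def shift (τ : CTy 𝕃) : CTy 𝕃 := τ.rename Nat.succ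

/-- The local type denoted by a type of local kind, which is a variable or a local type.  The last
value is a default for types of other kinds; local types never mention variables of other kinds. -/
def toLocal : CTy 𝕃 → 𝕃.Ty
  | var n => 𝕃.tvar n
  | lty t => t
  | _ => 𝕃.boolTy

/-- Lifting a type substitution under a binder of a type variable. -/
def up (σ : ℕ → CTy 𝕃) : ℕ → CTy 𝕃
  | 0 => var 0
  | n + 1 => (σ n).shift

/-- Parallel substitution. -/
def subst (σ : ℕ → CTy 𝕃) : CTy 𝕃 → CTy 𝕃
  | var n => σ n
  | lty t => lty (𝕃.tySubst (fun n => (σ n).toLocal) t)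
  | located t ρ => located (𝕃.tySubst (fun n => (σ n).toLocal) t) (ρ.subst σ)
  | arr τ₁ τ₂ => arr (τ₁.subst σ) (τ₂.subst σ)
  | all κ τ => all κ (τ.subst (up σ))
  | prod τ₁ τ₂ => prod (τ₁.subst σ) (τ₂.subst σ)
  | sum τ₁ τ₂ => sum (τ₁.subst σ) (τ₂.subst σ)
  | mu τ => mu (τ.subst (up σ))
  | loc L => loc L
  | empty => empty
  | sng l => sng (l.subst σ)
  | union ρ₁ ρ₂ => union (ρ₁.subst σ) (ρ₂.subst σ)

/-- The substitution of `t` for variable `0`. -/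
def one (t : CTy 𝕃) : ℕ → CTy 𝕃
  | 0 => t
  | n + 1 => var n

/-- A finite set of location names as a location set. -/
noncomputable def ofFinset (A : Finset Loc) : CTy 𝕃 :=
  A.toList.foldr (fun L ρ => union (sng (loc L)) ρ) empty

end CTy

/-- Necessary containment `□ (ℓ ∈ ρ)`, also written `ℓ ∈ ρ`. -/
inductive Nec : CTy 𝕃 → CTy 𝕃 → Prop
  | sng (l) : Nec l (.sng l)
  | left {l ρ₁ ρ₂} : Nec l ρ₁ → Nec l (.union ρ₁ ρ₂)
  | right {l ρ₁ ρ₂} : Nec l ρ₂ → Nec l (.union ρ₁ ρ₂)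

/-- Possible containment `◇ (ℓ ∈ ρ)`. -/
inductive Poss : CTy 𝕃 → CTy 𝕃 → Prop
  | var (l n) : Poss l (.var n)
  | sngVar (l n) : Poss l (.sng (.var n))
  | sngLoc (L) : Poss (.loc L) (.sng (.loc L))
  | left {l ρ₁ ρ₂} : Poss l ρ₁ → Poss l (.union ρ₁ ρ₂)
  | right {l ρ₁ ρ₂} : Poss l ρ₂ → Poss l (.union ρ₁ ρ₂)

/-- The locations possibly in `ρ`.  This is everything as soon as `ρ` mentions a variable, and
consists of location names otherwise, so it does not depend on the scope of `ρ`. -/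
def poss (ρ : CTy 𝕃) : Set (CTy 𝕃) := {l | Poss l ρ}

/-- The (necessary) subset relation `ρ₁ ⊆ ρ₂` of location sets. -/
inductive SubLoc : CTy 𝕃 → CTy 𝕃 → Prop
  | empty (ρ) : SubLoc .empty ρ
  | refl (ρ) : SubLoc ρ ρ
  | left {ρ ρ₁ ρ₂} : SubLoc ρ ρ₁ → SubLoc ρ (.union ρ₁ ρ₂)
  | right {ρ ρ₁ ρ₂} : SubLoc ρ ρ₂ → SubLoc ρ (.union ρ₁ ρ₂)
  | sng {l ρ} : Nec l ρ → SubLoc (.sng l) ρ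
  | union {ρ₁ ρ₂ ρ} : SubLoc ρ₁ ρ → SubLoc ρ₂ ρ → SubLoc (.union ρ₁ ρ₂) ρ

/-- The variables of local kind in a kinding context. -/
def localKinds (Γ : List Kind) : Set ℕ := {n | Γ[n]? = some Kind.lty}

/-- The kinding judgment `Γ ⊢ t :: κ`. -/
inductive Kinded : List Kind → CTy 𝕃 → Kind → Prop
  | var {Γ n κ} : Γ[n]? = some κ → Kinded Γ (.var n) κ
  | lty {Γ t} : 𝕃.Kinded (localKinds Γ) t → Kinded Γ (.lty t) .lty
  | located {Γ t ρ} : Kinded Γ (.lty t) .lty → Kinded Γ ρ .locSet →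
      Kinded Γ (.located t ρ) .chor
  | arr {Γ τ₁ τ₂} : Kinded Γ τ₁ .chor → Kinded Γ τ₂ .chor → Kinded Γ (.arr τ₁ τ₂) .chor
  | all {Γ κ τ} : Kinded (κ :: Γ) τ .chor → Kinded Γ (.all κ τ) .chor
  | prod {Γ τ₁ τ₂} : Kinded Γ τ₁ .chor → Kinded Γ τ₂ .chor → Kinded Γ (.prod τ₁ τ₂) .chor
  | sum {Γ τ₁ τ₂} : Kinded Γ τ₁ .chor → Kinded Γ τ₂ .chor → Kinded Γ (.sum τ₁ τ₂) .chor
  | mu {Γ τ} : Kinded (.chor :: Γ) τ .chor → Kinded Γ (.mu τ) .chor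
  | loc {Γ} (L) : Kinded Γ (.loc L) .loc
  | empty {Γ} : Kinded Γ .empty .locSet
  | sng {Γ l} : Kinded Γ l .loc → Kinded Γ (.sng l) .locSet
  | union {Γ ρ₁ ρ₂} : Kinded Γ ρ₁ .locSet → Kinded Γ ρ₂ .locSet → Kinded Γ (.union ρ₁ ρ₂) .locSet

/-- Selection labels. -/
inductive Choice : Type
  | left
  | right

/-- Choreographies.  Choreographic variables, local variables and type variables have one de Bruijn
index space each; the local variables of all locations share one. -/
inductive Chor (𝕃 : LocalLang.{u, v, w} Loc) : Type (max u v w)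
  /-- choreographic variable `X` -/
  | var (n : ℕ)
  /-- local computation `ρ.e` -/
  | comp (ρ : CTy 𝕃) (e : 𝕃.Expr)
  /-- recursive function `fun F(X : τ) := C`; in `C`, index `0` is `X` and index `1` is `F` -/
  | fn (τ : CTy 𝕃) (C : Chor 𝕃)
  | app (C₁ C₂ : Chor 𝕃)
  /-- `Λ α :: κ. C` -/
  | tabs (κ : Kind) (C : Chor 𝕃)
  | tapp (C : Chor 𝕃) (t : CTy 𝕃)
  | fold (C : Chor 𝕃)
  | unfold (C : Chor 𝕃)
  | pair (C₁ C₂ : Chor 𝕃)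
  | fst (C : Chor 𝕃)
  | snd (C : Chor 𝕃)
  | inl (C : Chor 𝕃)
  | inr (C : Chor 𝕃)
  /-- `case C of inl X => C₁ | inr Y => C₂` -/
  | caseOf (C C₁ C₂ : Chor 𝕃)
  /-- `let ρ.x : t := C₁ in C₂`, binding a local variable in `C₂` -/
  | letE (ρ : CTy 𝕃) (t : 𝕃.Ty) (C₁ C₂ : Chor 𝕃)
  /-- `let ρ.α :: κ := C₁ in C₂`, binding a type variable in `C₂` -/
  | letT (ρ : CTy 𝕃) (κ : Kind) (C₁ C₂ : Chor 𝕃)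
  /-- `ℓ` sends the result of `C` to `ρ` -/
  | send (C : Chor 𝕃) (l ρ : CTy 𝕃)
  /-- `ℓ` sends the selection `d` to `ρ`, then `C` -/
  | sync (l : CTy 𝕃) (d : Choice) (ρ : CTy 𝕃) (C : Chor 𝕃)
  /-- `if_ρ C then C₁ else C₂` -/
  | ite (ρ : CTy 𝕃) (C C₁ C₂ : Chor 𝕃)

/-- Weakening a local expression by one type variable. -/
def shiftTyE (e : 𝕃.Expr) : 𝕃.Expr := 𝕃.instTy (fun n => 𝕃.tvar (n + 1)) e

/-- Lifting a substitution of local expressions under a binder of a local variable. -/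
def upE (σ : ℕ → 𝕃.Expr) : ℕ → 𝕃.Expr
  | 0 => 𝕃.var 0
  | n + 1 => 𝕃.subst (fun m => 𝕃.var (m + 1)) (σ n)

/-- The substitution of `e` for local variable `0`. -/
def oneE (e : 𝕃.Expr) : ℕ → 𝕃.Expr
  | 0 => e
  | n + 1 => 𝕃.var n

namespace Chor

/-- Substitution of types. -/
def tsubst (σ : ℕ → CTy 𝕃) : Chor 𝕃 → Chor 𝕃
  | var n => var n
  | comp ρ e => comp (ρ.subst σ) (𝕃.instTy (fun n => (σ n).toLocal) e)
  | fn τ C => fn (τ.subst σ) (C.tsubst σ)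
  | app C₁ C₂ => app (C₁.tsubst σ) (C₂.tsubst σ)
  | tabs κ C => tabs κ (C.tsubst (CTy.up σ))
  | tapp C t => tapp (C.tsubst σ) (t.subst σ)
  | fold C => fold (C.tsubst σ)
  | unfold C => unfold (C.tsubst σ)
  | pair C₁ C₂ => pair (C₁.tsubst σ) (C₂.tsubst σ)
  | fst C => fst (C.tsubst σ)
  | snd C => snd (C.tsubst σ)
  | inl C => inl (C.tsubst σ)
  | inr C => inr (C.tsubst σ)
  | caseOf C C₁ C₂ => caseOf (C.tsubst σ) (C₁.tsubst σ) (C₂.tsubst σ)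
  | letE ρ t C₁ C₂ =>
      letE (ρ.subst σ) (𝕃.tySubst (fun n => (σ n).toLocal) t) (C₁.tsubst σ) (C₂.tsubst σ)
  | letT ρ κ C₁ C₂ => letT (ρ.subst σ) κ (C₁.tsubst σ) (C₂.tsubst (CTy.up σ))
  | send C l ρ => send (C.tsubst σ) (l.subst σ) (ρ.subst σ)
  | sync l d ρ C => sync (l.subst σ) d (ρ.subst σ) (C.tsubst σ)
  | ite ρ C C₁ C₂ => ite (ρ.subst σ) (C.tsubst σ) (C₁.tsubst σ) (C₂.tsubst σ)

/-- Substitution of local expressions for local variables. -/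
def esubst (σ : ℕ → 𝕃.Expr) : Chor 𝕃 → Chor 𝕃
  | var n => var n
  | comp ρ e => comp ρ (𝕃.subst σ e)
  | fn τ C => fn τ (C.esubst σ)
  | app C₁ C₂ => app (C₁.esubst σ) (C₂.esubst σ)
  | tabs κ C => tabs κ (C.esubst (fun n => shiftTyE (σ n)))
  | tapp C t => tapp (C.esubst σ) t
  | fold C => fold (C.esubst σ)
  | unfold C => unfold (C.esubst σ)
  | pair C₁ C₂ => pair (C₁.esubst σ) (C₂.esubst σ)
  | fst C => fst (C.esubst σ)
  | snd C => snd (C.esubst σ)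
  | inl C => inl (C.esubst σ)
  | inr C => inr (C.esubst σ)
  | caseOf C C₁ C₂ => caseOf (C.esubst σ) (C₁.esubst σ) (C₂.esubst σ)
  | letE ρ t C₁ C₂ => letE ρ t (C₁.esubst σ) (C₂.esubst (upE σ))
  | letT ρ κ C₁ C₂ => letT ρ κ (C₁.esubst σ) (C₂.esubst (fun n => shiftTyE (σ n)))
  | send C l ρ => send (C.esubst σ) l ρ
  | sync l d ρ C => sync l d ρ (C.esubst σ)
  | ite ρ C C₁ C₂ => ite ρ (C.esubst σ) (C₁.esubst σ) (C₂.esubst σ)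

/-- Renaming of choreographic variables. -/
def rename (ξ : ℕ → ℕ) : Chor 𝕃 → Chor 𝕃
  | var n => var (ξ n)
  | comp ρ e => comp ρ e
  | fn τ C => fn τ (C.rename (upRen (upRen ξ)))
  | app C₁ C₂ => app (C₁.rename ξ) (C₂.rename ξ)
  | tabs κ C => tabs κ (C.rename ξ)
  | tapp C t => tapp (C.rename ξ) t
  | fold C => fold (C.rename ξ)
  | unfold C => unfold (C.rename ξ)
  | pair C₁ C₂ => pair (C₁.rename ξ) (C₂.rename ξ)
  | fst C => fst (C.rename ξ)
  | snd C => snd (C.rename ξ)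
  | inl C => inl (C.rename ξ)
  | inr C => inr (C.rename ξ)
  | caseOf C C₁ C₂ => caseOf (C.rename ξ) (C₁.rename (upRen ξ)) (C₂.rename (upRen ξ))
  | letE ρ t C₁ C₂ => letE ρ t (C₁.rename ξ) (C₂.rename ξ)
  | letT ρ κ C₁ C₂ => letT ρ κ (C₁.rename ξ) (C₂.rename ξ)
  | send C l ρ => send (C.rename ξ) l ρ
  | sync l d ρ C => sync l d ρ (C.rename ξ)
  | ite ρ C C₁ C₂ => ite ρ (C.rename ξ) (C₁.rename ξ) (C₂.rename ξ)

/-- Lifting a substitution of choreographies under a binder of a choreographic variable. -/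
def up (σ : ℕ → Chor 𝕃) : ℕ → Chor 𝕃
  | 0 => var 0
  | n + 1 => (σ n).rename Nat.succ

/-- Weakening by one type variable. -/
def shiftT (C : Chor 𝕃) : Chor 𝕃 := C.tsubst (fun n => .var (n + 1))

/-- Weakening by one local variable. -/
def shiftE (C : Chor 𝕃) : Chor 𝕃 := C.esubst (fun n => 𝕃.var (n + 1))

/-- Substitution of choreographies for choreographic variables. -/
def subst (σ : ℕ → Chor 𝕃) : Chor 𝕃 → Chor 𝕃
  | var n => σ n
  | comp ρ e => comp ρ e
  | fn τ C => fn τ (C.subst (up (up σ)))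
  | app C₁ C₂ => app (C₁.subst σ) (C₂.subst σ)
  | tabs κ C => tabs κ (C.subst (fun n => (σ n).shiftT))
  | tapp C t => tapp (C.subst σ) t
  | fold C => fold (C.subst σ)
  | unfold C => unfold (C.subst σ)
  | pair C₁ C₂ => pair (C₁.subst σ) (C₂.subst σ)
  | fst C => fst (C.subst σ)
  | snd C => snd (C.subst σ)
  | inl C => inl (C.subst σ)
  | inr C => inr (C.subst σ)
  | caseOf C C₁ C₂ => caseOf (C.subst σ) (C₁.subst (up σ)) (C₂.subst (up σ))
  | letE ρ t C₁ C₂ => letE ρ t (C₁.subst σ) (C₂.subst (fun n => (σ n).shiftE))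
  | letT ρ κ C₁ C₂ => letT ρ κ (C₁.subst σ) (C₂.subst (fun n => (σ n).shiftT))
  | send C l ρ => send (C.subst σ) l ρ
  | sync l d ρ C => sync l d ρ (C.subst σ)
  | ite ρ C C₁ C₂ => ite ρ (C.subst σ) (C₁.subst σ) (C₂.subst σ)

/-- The substitution of `C` for choreographic variable `0`. -/
def one (C : Chor 𝕃) : ℕ → Chor 𝕃
  | 0 => C
  | n + 1 => var n

/-- The substitution of `C₀` for variable `0` and of `C₁` for variable `1`. -/
def two (C₀ C₁ : Chor 𝕃) : ℕ → Chor 𝕃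
  | 0 => C₀
  | 1 => C₁
  | n + 2 => var n

/-- Choreographic values. -/
inductive IsVal : Chor 𝕃 → Prop
  | comp {ρ v} : 𝕃.IsVal v → IsVal (comp ρ v)
  | fn {τ C} : IsVal (fn τ C)
  | tabs {κ C} : IsVal (tabs κ C)
  | pair {V₁ V₂} : IsVal V₁ → IsVal V₂ → IsVal (pair V₁ V₂)
  | inl {V} : IsVal V → IsVal (inl V)
  | inr {V} : IsVal V → IsVal (inr V)
  | fold {V} : IsVal V → IsVal (fold V)

end Chor

/-- Local contexts of choreographies: each local variable has a location set, where it is bound, and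
a local type. -/
abbrev LCtx (𝕃 : LocalLang.{u, v, w} Loc) := List (CTy 𝕃 × 𝕃.Ty)

/-- Weakening a local context by one type variable. -/
def LCtx.shift (S : LCtx 𝕃) : LCtx 𝕃 :=
  S.map fun p => (p.1.shift, 𝕃.tySubst (fun n => 𝕃.tvar (n + 1)) p.2)

open Classical in
/-- The variables of `S` that all locations in `ρ` can use. -/
noncomputable def LCtx.proj (S : LCtx 𝕃) (ρ : CTy 𝕃) : ℕ → Option 𝕃.Ty := fun x =>
  match S[x]? with
  | some (ρ', t) => if SubLoc ρ ρ' then some t else none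
  | none => none

/-- Well-formed contexts. -/
inductive WF : List Kind → List (CTy 𝕃) → LCtx 𝕃 → Prop
  | nil {Γ} : WF Γ [] []
  | add {Γ Δ S τ} : WF Γ Δ S → Kinded Γ τ .chor → WF Γ (τ :: Δ) S
  | addLocal {Γ Δ S ρ t} : WF Γ Δ S → Kinded Γ ρ .locSet → Kinded Γ (.lty t : CTy 𝕃) .lty →
      WF Γ Δ ((ρ, t) :: S)

/-- The typing judgment `Γ; Δ; S ⊢ C : τ`. -/
inductive Typed : List Kind → List (CTy 𝕃) → LCtx 𝕃 → Chor 𝕃 → CTy 𝕃 → Prop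
  | var {Γ Δ S n τ} : WF Γ Δ S → Δ[n]? = some τ → Typed Γ Δ S (.var n) τ
  | comp {Γ Δ S ρ e t} : WF Γ Δ S → Kinded Γ ρ .locSet →
      𝕃.Typed (localKinds Γ) (S.proj ρ) e t → Typed Γ Δ S (.comp ρ e) (.located t ρ)
  | fn {Γ Δ S τ₁ τ₂ C} : Typed Γ (τ₁ :: .arr τ₁ τ₂ :: Δ) S C τ₂ →
      Typed Γ Δ S (.fn τ₁ C) (.arr τ₁ τ₂)
  | app {Γ Δ S C₁ C₂ τ₁ τ₂} : Typed Γ Δ S C₁ (.arr τ₁ τ₂) → Typed Γ Δ S C₂ τ₁ →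
      Typed Γ Δ S (.app C₁ C₂) τ₂
  | tabs {Γ Δ S κ C τ} : Typed (κ :: Γ) (Δ.map CTy.shift) S.shift C τ →
      Typed Γ Δ S (.tabs κ C) (.all κ τ)
  | tapp {Γ Δ S κ C τ t} : Typed Γ Δ S C (.all κ τ) → Kinded Γ t κ →
      Typed Γ Δ S (.tapp C t) (τ.subst (CTy.one t))
  | fold {Γ Δ S C τ} : Kinded Γ (.mu τ) .chor → Typed Γ Δ S C (τ.subst (CTy.one (.mu τ))) →
      Typed Γ Δ S (.fold C) (.mu τ)
  | unfold {Γ Δ S C τ} : Typed Γ Δ S C (.mu τ) →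
      Typed Γ Δ S (.unfold C) (τ.subst (CTy.one (.mu τ)))
  | pair {Γ Δ S C₁ C₂ τ₁ τ₂} : Typed Γ Δ S C₁ τ₁ → Typed Γ Δ S C₂ τ₂ →
      Typed Γ Δ S (.pair C₁ C₂) (.prod τ₁ τ₂)
  | fst {Γ Δ S C τ₁ τ₂} : Typed Γ Δ S C (.prod τ₁ τ₂) → Typed Γ Δ S (.fst C) τ₁
  | snd {Γ Δ S C τ₁ τ₂} : Typed Γ Δ S C (.prod τ₁ τ₂) → Typed Γ Δ S (.snd C) τ₂
  | inl {Γ Δ S C τ₁ τ₂} : Typed Γ Δ S C τ₁ → Kinded Γ τ₂ .chor →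
      Typed Γ Δ S (.inl C) (.sum τ₁ τ₂)
  | inr {Γ Δ S C τ₁ τ₂} : Typed Γ Δ S C τ₂ → Kinded Γ τ₁ .chor →
      Typed Γ Δ S (.inr C) (.sum τ₁ τ₂)
  | caseOf {Γ Δ S C C₁ C₂ τ₁ τ₂ τ} : Typed Γ Δ S C (.sum τ₁ τ₂) →
      Typed Γ (τ₁ :: Δ) S C₁ τ → Typed Γ (τ₂ :: Δ) S C₂ τ → Typed Γ Δ S (.caseOf C C₁ C₂) τ
  | letE {Γ Δ S ρ ρ' t C₁ C₂ τ} : Typed Γ Δ S C₁ (.located t ρ') → SubLoc ρ ρ' →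
      Typed Γ Δ ((ρ, t) :: S) C₂ τ → Typed Γ Δ S (.letE ρ t C₁ C₂) τ
  | letLoc {Γ Δ S A ρ ρ' C₁ C₂ τ} : Typed Γ Δ S C₁ (.located (𝕃.locTy A) ρ') → SubLoc ρ ρ' →
      SubLoc (.ofFinset A) ρ → Kinded Γ τ .chor →
      Typed (.loc :: Γ) (Δ.map CTy.shift) S.shift C₂ τ.shift →
      Typed Γ Δ S (.letT ρ .loc C₁ C₂) τ
  | letLocSet {Γ Δ S A ρ ρ' C₁ C₂ τ} : Typed Γ Δ S C₁ (.located (𝕃.locSetTy A) ρ') →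
      SubLoc ρ ρ' → SubLoc (.ofFinset A) ρ → Kinded Γ τ .chor →
      Typed (.locSet :: Γ) (Δ.map CTy.shift) S.shift C₂ τ.shift →
      Typed Γ Δ S (.letT ρ .locSet C₁ C₂) τ
  | letLocalTy {Γ Δ S ρ ρ' C₁ C₂ τ} : Typed Γ Δ S C₁ (.located 𝕃.repTy ρ') → SubLoc ρ ρ' →
      Kinded Γ τ .chor → Typed (.lty :: Γ) (Δ.map CTy.shift) S.shift C₂ τ.shift →
      Typed Γ Δ S (.letT ρ .lty C₁ C₂) τ
  | send {Γ Δ S C t l ρ₁ ρ₂} : Typed Γ Δ S C (.located t ρ₁) → Nec l ρ₁ → Kinded Γ ρ₂ .locSet →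
      Typed Γ Δ S (.send C l ρ₂) (.located t (.union ρ₁ ρ₂))
  | sync {Γ Δ S C l d ρ τ} : Kinded Γ l .loc → Kinded Γ ρ .locSet → Typed Γ Δ S C τ →
      Typed Γ Δ S (.sync l d ρ C) τ
  | ite {Γ Δ S C C₁ C₂ ρ ρ' τ} : Typed Γ Δ S C (.located 𝕃.boolTy ρ') → SubLoc ρ ρ' →
      Typed Γ Δ S C₁ τ → Typed Γ Δ S C₂ τ → Typed Γ Δ S (.ite ρ C C₁ C₂) τ

/-- Messages: local values and selections. -/
inductive Msg (𝕃 : LocalLang.{u, v, w} Loc) : Type w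
  | val (v : 𝕃.Expr)
  | sel (d : Choice)

/-- Redices, the labels of choreographic steps. -/
inductive Redex (𝕃 : LocalLang.{u, v, w} Loc) : Type (max u v w)
  | comp (ρ : CTy 𝕃) (e₁ e₂ : 𝕃.Expr)
  | fn (R : Redex 𝕃)
  | arg (R : Redex 𝕃)
  | app
  | tapp
  | unfoldFold
  | pairL (R : Redex 𝕃)
  | pairR (R : Redex 𝕃)
  | fstPair
  | sndPair
  | caseInl
  | caseInr
  | letE (ρ : CTy 𝕃) (v : 𝕃.Expr)
  | letT (ρ t : CTy 𝕃)
  | send (l : CTy 𝕃) (m : Msg 𝕃) (ρ : CTy 𝕃)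
  | ifTrue (ρ : CTy 𝕃)
  | ifFalse (ρ : CTy 𝕃)

/-- The action of maps on types and on local expressions on messages and redices. -/
def Msg.map (g : 𝕃.Expr → 𝕃.Expr) : Msg 𝕃 → Msg 𝕃
  | val v => val (g v)
  | sel d => sel d

def Redex.map (f : CTy 𝕃 → CTy 𝕃) (g : 𝕃.Expr → 𝕃.Expr) : Redex 𝕃 → Redex 𝕃
  | comp ρ e₁ e₂ => comp (f ρ) (g e₁) (g e₂)
  | fn R => fn (R.map f g)
  | arg R => arg (R.map f g)
  | app => app
  | tapp => tapp
  | unfoldFold => unfoldFold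
  | pairL R => pairL (R.map f g)
  | pairR R => pairR (R.map f g)
  | fstPair => fstPair
  | sndPair => sndPair
  | caseInl => caseInl
  | caseInr => caseInr
  | letE ρ v => letE (f ρ) (g v)
  | letT ρ t => letT (f ρ) (f t)
  | send l m ρ => send (f l) (m.map g) (f ρ)
  | ifTrue ρ => ifTrue (f ρ)
  | ifFalse ρ => ifFalse (f ρ)

/-- Leaving the scope of variable `0`, which is renamed to `k`. -/
def exitScope (k : ℕ) : ℕ → ℕ
  | 0 => k
  | n + 1 => n

/-- A redex seen from outside a binder of a local variable.  If the bound variable occurs in the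
redex it is shown under the name `k`; if it does not, then `k` does not matter. -/
def Redex.exitE (k : ℕ) (R : Redex 𝕃) : Redex 𝕃 :=
  R.map id (𝕃.subst fun n => 𝕃.var (exitScope k n))

/-- A redex seen from outside a binder of a type variable, shown under the name `k`. -/
def Redex.exitT (k : ℕ) (R : Redex 𝕃) : Redex 𝕃 :=
  R.map (CTy.rename (exitScope k)) (𝕃.instTy fun n => 𝕃.tvar (exitScope k n))

/-- The locations (possibly) blocked by a redex; `Set.univ` is the set of all locations. -/
def Redex.rloc : Redex 𝕃 → Set (CTy 𝕃)
  | comp ρ _ _ => poss ρ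
  | fn R => R.rloc
  | arg R => R.rloc
  | app => Set.univ
  | tapp => Set.univ
  | unfoldFold => Set.univ
  | pairL R => R.rloc
  | pairR R => R.rloc
  | fstPair => Set.univ
  | sndPair => Set.univ
  | caseInl => Set.univ
  | caseInr => Set.univ
  | letE ρ _ => poss ρ
  | letT ρ _ => poss ρ
  | send l _ ρ => poss (.sng l) ∪ poss ρ
  | ifTrue ρ => poss ρ
  | ifFalse ρ => poss ρ

/-- The locations (possibly) blocked by a choreography. -/
def Chor.cloc : Chor 𝕃 → Set (CTy 𝕃)
  | var _ => ∅
  | comp ρ _ => poss ρ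
  | fn _ _ => ∅
  | app _ _ => Set.univ
  | tabs _ _ => ∅
  | tapp _ _ => Set.univ
  | fold C => C.cloc
  | unfold _ => Set.univ
  | pair C₁ C₂ => C₁.cloc ∪ C₂.cloc
  | fst _ => Set.univ
  | snd _ => Set.univ
  | inl C => C.cloc
  | inr C => C.cloc
  | caseOf _ _ _ => Set.univ
  | letE ρ _ C₁ C₂ => poss ρ ∪ C₁.cloc ∪ C₂.cloc
  | letT ρ _ C₁ C₂ => poss ρ ∪ C₁.cloc ∪ C₂.cloc
  | send C l ρ => poss (.sng l) ∪ poss ρ ∪ C.cloc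
  | sync l _ ρ C => poss (.sng l) ∪ poss ρ ∪ C.cloc
  | ite ρ C C₁ C₂ => poss ρ ∪ C.cloc ∪ C₁.cloc ∪ C₂.cloc

/-- Evaluation contexts (one layer). -/
inductive EvalCtx (𝕃 : LocalLang.{u, v, w} Loc) : Type (max u v w)
  | appL (C : Chor 𝕃)
  | appR (V : Chor 𝕃) (hV : V.IsVal)
  | tapp (t : CTy 𝕃)
  | fold
  | unfold
  | pairL (C : Chor 𝕃)
  | pairR (V : Chor 𝕃) (hV : V.IsVal)
  | fst
  | snd
  | inl
  | inr
  | caseOf (C₁ C₂ : Chor 𝕃)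
  | letE (ρ : CTy 𝕃) (t : 𝕃.Ty) (C₂ : Chor 𝕃)
  | letT (ρ : CTy 𝕃) (κ : Kind) (C₂ : Chor 𝕃)
  | send (l ρ : CTy 𝕃)
  | ite (ρ : CTy 𝕃) (C₁ C₂ : Chor 𝕃)

/-- Filling the hole. -/
def EvalCtx.fill : EvalCtx 𝕃 → Chor 𝕃 → Chor 𝕃
  | appL C₂, C => .app C C₂
  | appR V _, C => .app V C
  | tapp t, C => .tapp C t
  | fold, C => .fold C
  | unfold, C => .unfold C
  | pairL C₂, C => .pair C C₂
  | pairR V _, C => .pair V C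
  | fst, C => .fst C
  | snd, C => .snd C
  | inl, C => .inl C
  | inr, C => .inr C
  | caseOf C₁ C₂, C => .caseOf C C₁ C₂
  | letE ρ t C₂, C => .letE ρ t C C₂
  | letT ρ κ C₂, C => .letT ρ κ C C₂
  | send l ρ, C => .send C l ρ
  | ite ρ C₁ C₂, C => .ite ρ C C₁ C₂

/-- The redex that performs a given redex in an evaluation context. -/
def EvalCtx.redex : EvalCtx 𝕃 → Redex 𝕃 → Redex 𝕃
  | appL _, R => .fn R
  | appR _ _, R => .arg R
  | pairL _, R => .pairL R
  | pairR _ _, R => .pairR R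
  | _, R => R

/-- The type, location or location set that a local value represents. -/
noncomputable def resolve (𝕃 : LocalLang.{u, v, w} Loc) : Kind → 𝕃.Expr → Option (CTy 𝕃)
  | .chor, _ => none
  | .lty, v => (𝕃.asTy v).map CTy.lty
  | .loc, v => (𝕃.asLoc v).map CTy.loc
  | .locSet, v => (𝕃.asLocSet v).map CTy.ofFinset

/-- The operational semantics of choreographies: `Step C R C'` is the step from `C` to `C'` labelled
with the redex `R`.  The rules whose name ends in `I` are the out-of-order steps. -/
inductive Step : Chor 𝕃 → Redex 𝕃 → Chor 𝕃 → Prop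
  | ctx {C R C'} (η : EvalCtx 𝕃) : Step C R C' → Step (η.fill C) (η.redex R) (η.fill C')
  | comp {ρ e₁ e₂} : 𝕃.Step e₁ e₂ → Step (.comp ρ e₁) (.comp ρ e₁ e₂) (.comp ρ e₂)
  | app {τ C V} : V.IsVal → Step (.app (.fn τ C) V) .app (C.subst (Chor.two V (.fn τ C)))
  | tapp {κ C t} : Step (.tapp (.tabs κ C) t) .tapp (C.tsubst (CTy.one t))
  | unfoldFold {V} : V.IsVal → Step (.unfold (.fold V)) .unfoldFold V
  | fstPair {V₁ V₂} : V₁.IsVal → V₂.IsVal → Step (.fst (.pair V₁ V₂)) .fstPair V₁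
  | sndPair {V₁ V₂} : V₁.IsVal → V₂.IsVal → Step (.snd (.pair V₁ V₂)) .sndPair V₂
  | caseInl {V C₁ C₂} : V.IsVal →
      Step (.caseOf (.inl V) C₁ C₂) .caseInl (C₁.subst (Chor.one V))
  | caseInr {V C₁ C₂} : V.IsVal →
      Step (.caseOf (.inr V) C₁ C₂) .caseInr (C₂.subst (Chor.one V))
  | letEV {ρ ρ' t v C₂} : 𝕃.IsVal v →
      Step (.letE ρ t (.comp ρ' v) C₂) (.letE ρ v) (C₂.esubst (oneE v))
  | letEI {ρ t C₁ C₂ C₂' R} (k : ℕ) : Step C₂ R C₂' →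
      Disjoint (R.exitE k).rloc (poss ρ ∪ C₁.cloc) →
      Step (.letE ρ t C₁ C₂) (R.exitE k) (.letE ρ t C₁ C₂')
  | letTV {ρ ρ' κ v t C₂} : 𝕃.IsVal v → resolve 𝕃 κ v = some t →
      Step (.letT ρ κ (.comp ρ' v) C₂) (.letT ρ t) (C₂.tsubst (CTy.one t))
  | letTI {ρ κ C₁ C₂ C₂' R} (k : ℕ) : Step C₂ R C₂' →
      Disjoint (R.exitT k).rloc (poss ρ ∪ C₁.cloc) →
      Step (.letT ρ κ C₁ C₂) (R.exitT k) (.letT ρ κ C₁ C₂')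
  | sendV {ρ₁ v l ρ₂} : 𝕃.IsVal v →
      Step (.send (.comp ρ₁ v) l ρ₂) (.send l (.val v) ρ₂) (.comp (.union ρ₁ ρ₂) v)
  | sync {l d ρ C} : Step (.sync l d ρ C) (.send l (.sel d) ρ) C
  | syncI {l d ρ C C' R} : Step C R C' → Disjoint R.rloc (poss (.sng l) ∪ poss ρ) →
      Step (.sync l d ρ C) R (.sync l d ρ C')
  | ifT {ρ ρ' v C₁ C₂} : 𝕃.IsVal v → 𝕃.asBool v = some true →
      Step (.ite ρ (.comp ρ' v) C₁ C₂) (.ifTrue ρ) C₁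
  | ifF {ρ ρ' v C₁ C₂} : 𝕃.IsVal v → 𝕃.asBool v = some false →
      Step (.ite ρ (.comp ρ' v) C₁ C₂) (.ifFalse ρ) C₂
  | ifI {ρ C C₁ C₁' C₂ C₂' R} : Step C₁ R C₁' → Step C₂ R C₂' →
      Disjoint R.rloc (poss ρ ∪ C.cloc) → Step (.ite ρ C C₁ C₂) R (.ite ρ C C₁' C₂')
  | appI {C₁ C₂ C₂' R} : Step C₂ R C₂' → Disjoint R.rloc C₁.cloc →
      Step (.app C₁ C₂) (.arg R) (.app C₁ C₂')
  | pairI {C₁ C₂ C₂' R} : Step C₂ R C₂' → Disjoint R.rloc C₁.cloc →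
      Step (.pair C₁ C₂) (.pairR R) (.pair C₁ C₂')

end Calculus

end LambdaQC

universe u v w

/-!
Preservation rests on three substitution lemmas, for types, for local expressions and for
choreographies, and progress on canonical forms.  The delicate step is that of a message: the value
`v` sent to `ρ₂` has to be typable with the local variables shared by `ρ₁ ∪ ρ₂`, which may be fewer
than those of `ρ₁`.  This is clear if local values are closed.  Otherwise `Σ` is empty at the root,
and a redex that is reached under `let ρ.x := …` by an out-of-order step blocks no location of `ρ`.
The sender belongs to `ρ₁` and is blocked, so it cannot use any variable of `Σ`, and `v` is typed
without local variables.
-/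

namespace LambdaQC

variable {Loc : Type u} {𝕃 : LocalLang.{u, v, w} Loc}

/-! ### Renaming and substitution of types -/

namespace CTy

theorem up_var (ξ : ℕ → ℕ) :
    up (fun n => (var (ξ n) : CTy 𝕃)) = fun n => var (upRen ξ n) := by
  funext n; cases n <;> rfl

theorem up_upRen (ξ : ℕ → ℕ) (σ : ℕ → CTy 𝕃) :
    (fun n => up σ (upRen ξ n)) = up fun n => σ (ξ n) := by
  funext n; cases n <;> rfl

theorem rename_eq_subst (ξ : ℕ → ℕ) (τ : CTy 𝕃) : τ.rename ξ = τ.subst fun n => var (ξ n) := by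
  induction τ generalizing ξ <;> simp_all [rename, subst, up_var, toLocal]

theorem shift_eq_subst (τ : CTy 𝕃) : τ.shift = τ.subst fun n => var (n + 1) :=
  rename_eq_subst _ τ

theorem subst_var (τ : CTy 𝕃) : τ.subst var = τ := by
  have up_var_eq : up (var : ℕ → CTy 𝕃) = var := by funext n; cases n <;> rfl
  induction τ <;> simp_all [subst, toLocal, 𝕃.tySubst_id]

theorem toLocal_subst (σ : ℕ → CTy 𝕃) (τ : CTy 𝕃) :
    (τ.subst σ).toLocal = 𝕃.tySubst (fun n => (σ n).toLocal) τ.toLocal := by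
  cases τ <;> simp [subst, toLocal, 𝕃.tySubst_tvar, 𝕃.subst_boolTy]

theorem toLocal_rename (ξ : ℕ → ℕ) (τ : CTy 𝕃) :
    (τ.rename ξ).toLocal = 𝕃.tySubst (fun n => 𝕃.tvar (ξ n)) τ.toLocal := by
  rw [rename_eq_subst, toLocal_subst]; rfl

theorem rename_subst (ξ : ℕ → ℕ) (σ : ℕ → CTy 𝕃) (τ : CTy 𝕃) :
    (τ.rename ξ).subst σ = τ.subst fun n => σ (ξ n) := by
  induction τ generalizing ξ σ <;>
    simp_all [rename, subst, up_upRen, 𝕃.tySubst_comp, 𝕃.tySubst_tvar]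

theorem rename_rename (ξ ζ : ℕ → ℕ) (τ : CTy 𝕃) :
    (τ.rename ξ).rename ζ = τ.rename fun n => ζ (ξ n) := by
  rw [rename_eq_subst ζ, rename_subst, rename_eq_subst]

theorem rename_upRen_up (σ : ℕ → CTy 𝕃) (ξ : ℕ → ℕ) :
    (fun n => (up σ n).rename (upRen ξ)) = up fun n => (σ n).rename ξ := by
  funext n
  cases n with
  | zero => rfl
  | succ n => simp only [up, shift, rename_rename, upRen, Nat.succ_eq_add_one]

theorem subst_rename (σ : ℕ → CTy 𝕃) (ξ : ℕ → ℕ) (τ : CTy 𝕃) :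
    (τ.subst σ).rename ξ = τ.subst fun n => (σ n).rename ξ := by
  induction τ generalizing ξ σ <;>
    simp_all [rename, subst, rename_upRen_up, 𝕃.tySubst_comp, toLocal_rename]

theorem shift_subst_up (σ : ℕ → CTy 𝕃) (τ : CTy 𝕃) :
    τ.shift.subst (up σ) = (τ.subst σ).shift := by
  rw [shift, shift, rename_subst, subst_rename]; rfl

theorem up_subst_up (σ θ : ℕ → CTy 𝕃) :
    (fun n => (up σ n).subst (up θ)) = up fun n => (σ n).subst θ := by
  funext n
  cases n with
  | zero => rfl
  | succ n => exact shift_subst_up θ (σ n)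

theorem subst_subst (σ θ : ℕ → CTy 𝕃) (τ : CTy 𝕃) :
    (τ.subst σ).subst θ = τ.subst fun n => (σ n).subst θ := by
  induction τ generalizing σ θ <;>
    simp_all [subst, up_subst_up, 𝕃.tySubst_comp, toLocal_subst]

theorem shift_subst_one (t τ : CTy 𝕃) : τ.shift.subst (one t) = τ := by
  rw [shift, rename_subst]; exact subst_var τ

theorem subst_one_subst (σ : ℕ → CTy 𝕃) (t τ : CTy 𝕃) :
    (τ.subst (one t)).subst σ = (τ.subst (up σ)).subst (one (t.subst σ)) := by
  rw [subst_subst, subst_subst]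
  congr 1
  funext n
  cases n with
  | zero => rfl
  | succ n => exact (shift_subst_one _ _).symm

theorem subst_ofFinset (σ : ℕ → CTy 𝕃) (A : Finset Loc) :
    (ofFinset A : CTy 𝕃).subst σ = ofFinset A := by
  unfold ofFinset
  induction A.toList <;> simp_all [subst]

theorem map_shift_eq_map_subst (Δ : List (CTy 𝕃)) :
    Δ.map shift = Δ.map (subst fun n => var (n + 1)) :=
  List.map_congr_left fun τ _ => shift_eq_subst τ

theorem map_shift_subst_up (σ : ℕ → CTy 𝕃) (Δ : List (CTy 𝕃)) :
    (Δ.map shift).map (subst (up σ)) = (Δ.map (subst σ)).map shift := by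
  simp [shift_subst_up]

theorem map_shift_subst_one (t : CTy 𝕃) (Δ : List (CTy 𝕃)) :
    (Δ.map shift).map (subst (one t)) = Δ := by
  simp [shift_subst_one, Function.comp_def]

end CTy

/-! ### Containment of locations -/

section Containment

variable {l ρ ρ₁ ρ₂ ρ₃ : CTy 𝕃}

theorem Nec.subst (σ : ℕ → CTy 𝕃) (h : Nec l ρ) : Nec (l.subst σ) (ρ.subst σ) := by
  induction h with
  | sng => exact .sng _
  | left _ ih => exact .left ih
  | right _ ih => exact .right ih

theorem SubLoc.subst (σ : ℕ → CTy 𝕃) (h : SubLoc ρ₁ ρ₂) :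
    SubLoc (ρ₁.subst σ) (ρ₂.subst σ) := by
  induction h with
  | empty => exact .empty _
  | refl => exact .refl _
  | left _ ih => exact .left ih
  | right _ ih => exact .right ih
  | sng h => exact .sng (h.subst σ)
  | union _ _ ih₁ ih₂ => exact .union ih₁ ih₂

theorem Nec.mono (h : Nec l ρ₁) (hs : SubLoc ρ₁ ρ₂) : Nec l ρ₂ := by
  induction hs with
  | empty => cases h
  | refl => exact h
  | left _ ih => exact .left (ih h)
  | right _ ih => exact .right (ih h)
  | sng hn => cases h; exact hn
  | union _ _ ih₁ ih₂ =>
    cases h with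
    | left h => exact ih₁ h
    | right h => exact ih₂ h

theorem SubLoc.of_union (h : SubLoc (.union ρ₁ ρ₂) ρ) : SubLoc ρ₁ ρ ∧ SubLoc ρ₂ ρ := by
  generalize hu : CTy.union ρ₁ ρ₂ = u at h
  induction h with
  | empty => cases hu
  | refl => subst hu; exact ⟨.left (.refl _), .right (.refl _)⟩
  | left _ ih => exact ⟨.left (ih hu).1, .left (ih hu).2⟩
  | right _ ih => exact ⟨.right (ih hu).1, .right (ih hu).2⟩
  | sng => cases hu
  | union h₁ h₂ => cases hu; exact ⟨h₁, h₂⟩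

theorem SubLoc.trans (h₁₂ : SubLoc ρ₁ ρ₂) (h₂₃ : SubLoc ρ₂ ρ₃) : SubLoc ρ₁ ρ₃ := by
  induction h₁₂ with
  | empty => exact .empty _
  | refl => exact h₂₃
  | left _ ih => exact ih h₂₃.of_union.1
  | right _ ih => exact ih h₂₃.of_union.2
  | sng h => exact .sng (h.mono h₂₃)
  | union _ _ ih₁ ih₂ => exact .union (ih₁ h₂₃) (ih₂ h₂₃)

theorem Poss.rename_right (ξ : ℕ → ℕ) (h : Poss l ρ) : Poss l (ρ.rename ξ) := by
  induction h with
  | var => exact .var _ _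
  | sngVar => exact .sngVar _ _
  | sngLoc => exact .sngLoc _
  | left _ ih => exact .left ih
  | right _ ih => exact .right ih

theorem Poss.of_rename_right {ξ : ℕ → ℕ} (h : Poss l (ρ.rename ξ)) : Poss l ρ := by
  induction ρ with
  | var => exact .var _ _
  | sng l' =>
    cases l' <;> cases h
    · exact .sngVar _ _
    · exact .sngLoc _
  | union _ _ ih₁ ih₂ =>
    cases h with
    | left h => exact .left (ih₁ h)
    | right h => exact .right (ih₂ h)
  | _ => cases h

theorem poss_rename (ξ : ℕ → ℕ) (ρ : CTy 𝕃) : poss (ρ.rename ξ) = poss ρ :=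
  Set.ext fun _ => ⟨Poss.of_rename_right, Poss.rename_right ξ⟩

end Containment

/-! ### Kinding -/

/-- `ξ` sends each variable of the context `Γ` to a variable of `Γ'` with the same declaration.  It
serves for contexts of type variables and of choreographic variables. -/
def Renames {α : Type*} (Γ Γ' : List α) (ξ : ℕ → ℕ) : Prop :=
  ∀ n a, Γ[n]? = some a → Γ'[ξ n]? = some a

namespace Renames

variable {α β : Type*} {Γ Γ' : List α} {ξ : ℕ → ℕ}

theorem upRen (h : Renames Γ Γ' ξ) (a : α) : Renames (a :: Γ) (a :: Γ') (upRen ξ)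
  | 0, _, hn => hn
  | n + 1, b, hn => h n b hn

theorem succ (Γ : List α) (a : α) : Renames Γ (a :: Γ) Nat.succ :=
  fun _ _ h => h

theorem map (h : Renames Γ Γ' ξ) (f : α → β) : Renames (Γ.map f) (Γ'.map f) ξ := by
  intro n b hn
  rw [List.getElem?_map, Option.map_eq_some_iff] at hn ⊢
  obtain ⟨a, hn, rfl⟩ := hn
  exact ⟨a, h n a hn, rfl⟩

end Renames

/-- `σ` replaces the type variables of `Γ` by types that are well-kinded in `Γ'`. -/
def TySubst (Γ Γ' : List Kind) (σ : ℕ → CTy 𝕃) : Prop :=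
  ∀ n κ, Γ[n]? = some κ → Kinded Γ' (σ n) κ

section Kinding

variable {Γ Γ' : List Kind} {σ : ℕ → CTy 𝕃} {l ρ t τ : CTy 𝕃} {κ κ' : Kind}

theorem Kinded.toLocal (h : Kinded Γ t .lty) : 𝕃.Kinded (localKinds Γ) t.toLocal := by
  cases h with
  | var h => exact 𝕃.kinded_tvar _ _ h
  | lty h => exact h

theorem Kinded.rename {ξ : ℕ → ℕ} (h : Kinded Γ τ κ) (hξ : Renames Γ Γ' ξ) :
    Kinded Γ' (τ.rename ξ) κ := by
  induction h generalizing Γ' ξ with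
  | var h => exact .var (hξ _ _ h)
  | lty h => exact .lty (𝕃.kinded_subst _ _ _ _ h fun α hα => 𝕃.kinded_tvar _ _ (hξ _ _ hα))
  | located _ _ ih₁ ih₂ => exact .located (ih₁ hξ) (ih₂ hξ)
  | arr _ _ ih₁ ih₂ => exact .arr (ih₁ hξ) (ih₂ hξ)
  | all _ ih => exact .all (ih (hξ.upRen _))
  | prod _ _ ih₁ ih₂ => exact .prod (ih₁ hξ) (ih₂ hξ)
  | sum _ _ ih₁ ih₂ => exact .sum (ih₁ hξ) (ih₂ hξ)
  | mu _ ih => exact .mu (ih (hξ.upRen _))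
  | loc L => exact .loc L
  | empty => exact .empty
  | sng _ ih => exact .sng (ih hξ)
  | union _ _ ih₁ ih₂ => exact .union (ih₁ hξ) (ih₂ hξ)

theorem Kinded.shift (h : Kinded Γ τ κ) (κ' : Kind) : Kinded (κ' :: Γ) τ.shift κ :=
  h.rename (.succ Γ κ')

theorem TySubst.up (hσ : TySubst Γ Γ' σ) (κ : Kind) : TySubst (κ :: Γ) (κ :: Γ') (CTy.up σ)
  | 0, _, h => .var h
  | n + 1, κ', h => (hσ n κ' h).shift κ

theorem TySubst.weaken (Γ : List Kind) (κ : Kind) :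
    TySubst Γ (κ :: Γ) fun n => (.var (n + 1) : CTy 𝕃) :=
  fun _ _ h => .var h

theorem TySubst.one (h : Kinded Γ t κ) : TySubst (κ :: Γ) Γ (CTy.one t)
  | 0, _, rfl => h
  | _ + 1, _, hn => .var hn

theorem Kinded.subst (h : Kinded Γ τ κ) (hσ : TySubst Γ Γ' σ) : Kinded Γ' (τ.subst σ) κ := by
  induction h generalizing Γ' σ with
  | var h => exact hσ _ _ h
  | lty h => exact .lty (𝕃.kinded_subst _ _ _ _ h fun α hα => (hσ _ _ hα).toLocal)
  | located _ _ ih₁ ih₂ => exact .located (ih₁ hσ) (ih₂ hσ)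
  | arr _ _ ih₁ ih₂ => exact .arr (ih₁ hσ) (ih₂ hσ)
  | all _ ih => exact .all (ih (hσ.up _))
  | prod _ _ ih₁ ih₂ => exact .prod (ih₁ hσ) (ih₂ hσ)
  | sum _ _ ih₁ ih₂ => exact .sum (ih₁ hσ) (ih₂ hσ)
  | mu _ ih => exact .mu (ih (hσ.up _))
  | loc L => exact .loc L
  | empty => exact .empty
  | sng _ ih => exact .sng (ih hσ)
  | union _ _ ih₁ ih₂ => exact .union (ih₁ hσ) (ih₂ hσ)

-- Undo the renaming by a substitution; it sends the variables outside the range of `ξ` to `bool`,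
-- which is well-kinded in every context.
theorem LocalLang.kinded_of_rename {Γ Γ' : Set ℕ} {ξ : ℕ → ℕ} {t : 𝕃.Ty}
    (hξ : Function.Injective ξ) (hΓ : ∀ n, ξ n ∈ Γ → n ∈ Γ')
    (h : 𝕃.Kinded Γ (𝕃.tySubst (fun n => 𝕃.tvar (ξ n)) t)) : 𝕃.Kinded Γ' t := by
  let θ : ℕ → 𝕃.Ty := Function.extend ξ 𝕃.tvar fun _ => 𝕃.boolTy
  have hθ (n : ℕ) : θ (ξ n) = 𝕃.tvar n := hξ.extend_apply _ _ n
  have kinded_θ : ∀ α ∈ Γ, 𝕃.Kinded Γ' (θ α) := by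
    intro α hα
    by_cases hr : ∃ n, ξ n = α
    · obtain ⟨n, rfl⟩ := hr
      exact hθ n ▸ 𝕃.kinded_tvar _ _ (hΓ n hα)
    · simp only [θ, Function.extend_apply' _ _ _ hr, 𝕃.kinded_boolTy]
  simpa only [𝕃.tySubst_comp, 𝕃.tySubst_tvar, hθ, 𝕃.tySubst_id] using
    𝕃.kinded_subst _ _ θ _ h kinded_θ

theorem upRen_injective {ξ : ℕ → ℕ} (h : Function.Injective ξ) : Function.Injective (upRen ξ)
  | 0, 0, _ => rfl
  | _ + 1, _ + 1, he => congrArg Nat.succ (h (Nat.succ.inj he))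

theorem Kinded.of_rename {ξ : ℕ → ℕ} (hξ : Function.Injective ξ)
    (hΓ : ∀ n κ, Γ[ξ n]? = some κ → Γ'[n]? = some κ) (h : Kinded Γ (τ.rename ξ) κ) :
    Kinded Γ' τ κ := by
  have up {Γ Γ' : List Kind} {ξ : ℕ → ℕ} (κ : Kind)
      (hΓ : ∀ n κ, Γ[ξ n]? = some κ → Γ'[n]? = some κ) :
      ∀ n κ', (κ :: Γ)[upRen ξ n]? = some κ' → (κ :: Γ')[n]? = some κ'
    | 0, _, h => h
    | n + 1, κ', h => hΓ n κ' h
  induction τ generalizing Γ Γ' ξ κ with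
  | var => let .var h := h; exact .var (hΓ _ _ h)
  | lty => let .lty h := h; exact .lty (𝕃.kinded_of_rename hξ (hΓ · .lty) h)
  | located _ _ ih =>
    let .located (.lty h₁) h₂ := h
    exact .located (.lty (𝕃.kinded_of_rename hξ (hΓ · .lty) h₁)) (ih hξ hΓ h₂)
  | arr _ _ ih₁ ih₂ => let .arr h₁ h₂ := h; exact .arr (ih₁ hξ hΓ h₁) (ih₂ hξ hΓ h₂)
  | all _ _ ih => let .all h := h; exact .all (ih (upRen_injective hξ) (up _ hΓ) h)
  | prod _ _ ih₁ ih₂ => let .prod h₁ h₂ := h; exact .prod (ih₁ hξ hΓ h₁) (ih₂ hξ hΓ h₂)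
  | sum _ _ ih₁ ih₂ => let .sum h₁ h₂ := h; exact .sum (ih₁ hξ hΓ h₁) (ih₂ hξ hΓ h₂)
  | mu _ ih => let .mu h := h; exact .mu (ih (upRen_injective hξ) (up _ hΓ) h)
  | loc => let .loc _ := h; exact .loc _
  | empty => let .empty := h; exact .empty
  | sng _ ih => let .sng h := h; exact .sng (ih hξ hΓ h)
  | union _ _ ih₁ ih₂ => let .union h₁ h₂ := h; exact .union (ih₁ hξ hΓ h₁) (ih₂ hξ hΓ h₂)

theorem Kinded.of_shift (h : Kinded (κ' :: Γ) τ.shift κ) : Kinded Γ τ κ :=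
  Kinded.of_rename Nat.succ_injective (fun _ _ h => h) h

theorem Kinded.ofFinset (Γ : List Kind) (A : Finset Loc) :
    Kinded Γ (CTy.ofFinset A : CTy 𝕃) .locSet := by
  unfold CTy.ofFinset
  induction A.toList with
  | nil => exact .empty
  | cons L _ ih => exact .union (.sng (.loc L)) ih

theorem Nec.kinded (hn : Nec l ρ) (h : Kinded Γ ρ .locSet) : Kinded Γ l .loc := by
  induction hn with
  | sng => let .sng h := h; exact h
  | left _ ih => let .union h _ := h; exact ih h
  | right _ ih => let .union _ h := h; exact ih h

theorem Nec.poss (hn : Nec l ρ) (hl : Kinded Γ l .loc) : Poss l ρ := by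
  induction hn with
  | sng =>
    cases hl with
    | var => exact .sngVar _ _
    | loc L => exact .sngLoc L
  | left _ ih => exact .left ih
  | right _ ih => exact .right ih

end Kinding

/-! ### Contexts -/

section Contexts

variable {Γ Γ' : List Kind} {Δ : List (CTy 𝕃)} {S : LCtx 𝕃} {ρ ρ₁ ρ₂ τ : CTy 𝕃} {x : ℕ} {t : 𝕃.Ty}
  {κ : Kind} {σ : ℕ → CTy 𝕃}

theorem wf_iff : WF Γ Δ S ↔ (∀ τ ∈ Δ, Kinded Γ τ .chor) ∧
    ∀ p ∈ S, Kinded Γ p.1 .locSet ∧ Kinded Γ (.lty p.2 : CTy 𝕃) .lty := by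
  constructor
  · intro h
    induction h with
    | nil => simp
    | add _ h ih => exact ⟨List.forall_mem_cons.2 ⟨h, ih.1⟩, ih.2⟩
    | addLocal _ h₁ h₂ ih => exact ⟨ih.1, List.forall_mem_cons.2 ⟨⟨h₁, h₂⟩, ih.2⟩⟩
  · rintro ⟨hΔ, hS⟩
    induction S with
    | nil =>
      induction Δ with
      | nil => exact .nil
      | cons τ Δ ih =>
        obtain ⟨hτ, hΔ⟩ := List.forall_mem_cons.1 hΔ
        exact .add (ih hΔ) hτ
    | cons p S ih =>
      obtain ⟨⟨hρ, ht⟩, hS⟩ := List.forall_mem_cons.1 hS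
      exact .addLocal (ih hS) hρ ht

theorem WF.tail (h : WF Γ (τ :: Δ) S) : WF Γ Δ S :=
  wf_iff.2 ⟨(List.forall_mem_cons.1 (wf_iff.1 h).1).2, (wf_iff.1 h).2⟩

theorem WF.head (h : WF Γ (τ :: Δ) S) : Kinded Γ τ .chor :=
  (List.forall_mem_cons.1 (wf_iff.1 h).1).1

theorem WF.localHead (h : WF Γ Δ ((ρ, t) :: S)) :
    Kinded Γ ρ .locSet ∧ Kinded Γ (.lty t : CTy 𝕃) .lty :=
  (List.forall_mem_cons.1 (wf_iff.1 h).2).1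

namespace LCtx

/-- Substitution of types in a local context. -/
def tsubst (σ : ℕ → CTy 𝕃) (S : LCtx 𝕃) : LCtx 𝕃 :=
  S.map fun p => (p.1.subst σ, 𝕃.tySubst (fun n => (σ n).toLocal) p.2)

theorem shift_eq_tsubst (S : LCtx 𝕃) : S.shift = S.tsubst fun n => .var (n + 1) :=
  List.map_congr_left fun p _ => by rw [CTy.shift_eq_subst]; rfl

theorem tsubst_tsubst (σ θ : ℕ → CTy 𝕃) (S : LCtx 𝕃) :
    (S.tsubst σ).tsubst θ = S.tsubst fun n => (σ n).subst θ := by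
  simp [tsubst, CTy.subst_subst, 𝕃.tySubst_comp, CTy.toLocal_subst]

theorem tsubst_var (S : LCtx 𝕃) : S.tsubst CTy.var = S := by
  simp [tsubst, CTy.subst_var, CTy.toLocal, 𝕃.tySubst_id]

theorem shift_tsubst_up (σ : ℕ → CTy 𝕃) (S : LCtx 𝕃) :
    S.shift.tsubst (CTy.up σ) = (S.tsubst σ).shift := by
  rw [shift_eq_tsubst, shift_eq_tsubst, tsubst_tsubst, tsubst_tsubst]
  congr 1
  funext n
  exact CTy.shift_eq_subst _

theorem shift_tsubst_one (t : CTy 𝕃) (S : LCtx 𝕃) : S.shift.tsubst (CTy.one t) = S := by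
  rw [shift_eq_tsubst, tsubst_tsubst]
  exact tsubst_var S

theorem proj_eq_some : S.proj ρ x = some t ↔ ∃ ρ', S[x]? = some (ρ', t) ∧ SubLoc ρ ρ' := by
  unfold proj
  rcases S[x]? with _ | ⟨ρ', t'⟩
  · simp
  · simp [ite_eq_iff, and_comm]

theorem proj_mono (h : SubLoc ρ₁ ρ₂) (hx : S.proj ρ₂ x = some t) : S.proj ρ₁ x = some t := by
  obtain ⟨ρ, hx, hρ⟩ := proj_eq_some.1 hx
  exact proj_eq_some.2 ⟨ρ, hx, h.trans hρ⟩

theorem proj_tsubst (σ : ℕ → CTy 𝕃)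
    (h : (S.proj ρ x).map (𝕃.tySubst fun n => (σ n).toLocal) = some t) :
    (S.tsubst σ).proj (ρ.subst σ) x = some t := by
  obtain ⟨t, ht, rfl⟩ := Option.map_eq_some_iff.1 h
  obtain ⟨ρ', hx, hs⟩ := proj_eq_some.1 ht
  exact proj_eq_some.2 ⟨ρ'.subst σ, by simp [tsubst, hx], hs.subst σ⟩

end LCtx

theorem WF.tsubst (h : WF Γ Δ S) (hσ : TySubst Γ Γ' σ) :
    WF Γ' (Δ.map (CTy.subst σ)) (S.tsubst σ) := by
  induction h with
  | nil => exact .nil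
  | add _ h ih => exact .add ih (h.subst hσ)
  | addLocal _ h₁ h₂ ih => exact .addLocal ih (h₁.subst hσ) (h₂.subst hσ)

theorem WF.shift (h : WF Γ Δ S) (κ : Kind) : WF (κ :: Γ) (Δ.map CTy.shift) S.shift := by
  rw [LCtx.shift_eq_tsubst, CTy.map_shift_eq_map_subst]
  exact h.tsubst (.weaken Γ κ)

theorem WF.of_shift (h : WF (κ :: Γ) (Δ.map CTy.shift) S.shift) : WF Γ Δ S := by
  obtain ⟨hΔ, hS⟩ := wf_iff.1 h
  refine wf_iff.2 ⟨fun τ hτ => (hΔ _ (List.mem_map_of_mem hτ)).of_shift, fun p hp => ?_⟩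
  obtain ⟨hρ, ht⟩ := hS _ (List.mem_map_of_mem hp)
  exact ⟨hρ.of_shift, Kinded.of_shift ht⟩

theorem WF.kinded_proj (h : WF Γ Δ S) (hx : S.proj ρ x = some t) : 𝕃.Kinded (localKinds Γ) t := by
  obtain ⟨ρ', hx, -⟩ := LCtx.proj_eq_some.1 hx
  exact ((wf_iff.1 h).2 _ (List.mem_of_getElem? hx)).2.toLocal

end Contexts

theorem LocalLang.typed_mono {Γ : Set ℕ} {S S' : ℕ → Option 𝕃.Ty} {e : 𝕃.Expr} {t : 𝕃.Ty}
    (h : 𝕃.Typed Γ S e t) (hS : ∀ x s, S x = some s → S' x = some s)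
    (hS' : ∀ x s, S' x = some s → 𝕃.Kinded Γ s) : 𝕃.Typed Γ S' e t := by
  simpa only [𝕃.subst_id] using
    𝕃.typed_subst _ _ _ 𝕃.var _ _ h hS' fun x s hx => 𝕃.typed_var _ _ _ _ hS' (hS x s hx)

/-! ### Substitution in choreographies -/

section Substitution

variable {Γ Γ' : List Kind} {Δ Δ' : List (CTy 𝕃)} {S S' : LCtx 𝕃} {C C₀ C₁ : Chor 𝕃}
  {ρ τ τ₀ τ₁ : CTy 𝕃} {t : 𝕃.Ty} {e : 𝕃.Expr} {κ : Kind}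

theorem Typed.wf (h : Typed Γ Δ S C τ) : WF Γ Δ S := by
  induction h with
  | var h => exact h
  | comp h => exact h
  | fn _ ih => exact ih.tail.tail
  | tabs _ ih => exact ih.of_shift
  | _ => assumption

theorem typed_shift_subst_up {σ : ℕ → CTy 𝕃} :
    Typed Γ ((Δ.map CTy.shift).map (CTy.subst (CTy.up σ))) (S.shift.tsubst (CTy.up σ)) C
      (τ.shift.subst (CTy.up σ)) ↔
    Typed Γ ((Δ.map (CTy.subst σ)).map CTy.shift) (S.tsubst σ).shift C (τ.subst σ).shift := by
  rw [CTy.map_shift_subst_up, LCtx.shift_tsubst_up, CTy.shift_subst_up]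

theorem Typed.tsubst {σ : ℕ → CTy 𝕃} (h : Typed Γ Δ S C τ) (hσ : TySubst Γ Γ' σ) :
    Typed Γ' (Δ.map (CTy.subst σ)) (S.tsubst σ) (C.tsubst σ) (τ.subst σ) := by
  induction h generalizing Γ' σ with
  | var h hn => exact .var (h.tsubst hσ) (by simp [hn])
  | comp h hρ he =>
    have he' := 𝕃.typed_instTy _ (localKinds Γ') _ _ _ _ he fun α hα => (hσ _ _ hα).toLocal
    exact .comp (h.tsubst hσ) (hρ.subst hσ)
      (𝕃.typed_mono he' (fun _ _ => LCtx.proj_tsubst σ) fun _ _ => (h.tsubst hσ).kinded_proj)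
  | fn _ ih => exact .fn (ih hσ)
  | app _ _ ih₁ ih₂ => exact .app (ih₁ hσ) (ih₂ hσ)
  | tabs _ ih =>
    exact .tabs (by simpa only [CTy.map_shift_subst_up, LCtx.shift_tsubst_up] using ih (hσ.up _))
  | tapp _ ht ih => rw [CTy.subst_one_subst]; exact .tapp (ih hσ) (ht.subst hσ)
  | fold hk _ ih =>
    have h := ih hσ
    rw [CTy.subst_one_subst] at h
    exact .fold (hk.subst hσ) h
  | unfold _ ih => rw [CTy.subst_one_subst]; exact .unfold (ih hσ)
  | pair _ _ ih₁ ih₂ => exact .pair (ih₁ hσ) (ih₂ hσ)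
  | fst _ ih => exact .fst (ih hσ)
  | snd _ ih => exact .snd (ih hσ)
  | inl _ hk ih => exact .inl (ih hσ) (hk.subst hσ)
  | inr _ hk ih => exact .inr (ih hσ) (hk.subst hσ)
  | caseOf _ _ _ ih ih₁ ih₂ => exact .caseOf (ih hσ) (ih₁ hσ) (ih₂ hσ)
  | letE _ hs _ ih₁ ih₂ => exact .letE (ih₁ hσ) (hs.subst σ) (ih₂ hσ)
  | letLoc _ hs hA hk _ ih₁ ih₂ =>
    exact .letLoc (by simpa only [CTy.subst, 𝕃.subst_locTy] using ih₁ hσ) (hs.subst σ)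
      (by simpa only [CTy.subst_ofFinset] using hA.subst σ) (hk.subst hσ)
      (typed_shift_subst_up.1 (ih₂ (hσ.up _)))
  | letLocSet _ hs hA hk _ ih₁ ih₂ =>
    exact .letLocSet (by simpa only [CTy.subst, 𝕃.subst_locSetTy] using ih₁ hσ) (hs.subst σ)
      (by simpa only [CTy.subst_ofFinset] using hA.subst σ) (hk.subst hσ)
      (typed_shift_subst_up.1 (ih₂ (hσ.up _)))
  | letLocalTy _ hs hk _ ih₁ ih₂ =>
    exact .letLocalTy (by simpa only [CTy.subst, 𝕃.subst_repTy] using ih₁ hσ) (hs.subst σ)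
      (hk.subst hσ) (typed_shift_subst_up.1 (ih₂ (hσ.up _)))
  | send _ hn hk ih => exact .send (ih hσ) (hn.subst σ) (hk.subst hσ)
  | sync hl hk _ ih => exact .sync (hl.subst hσ) (hk.subst hσ) (ih hσ)
  | ite _ hs _ _ ih ih₁ ih₂ =>
    exact .ite (by simpa only [CTy.subst, 𝕃.subst_boolTy] using ih hσ) (hs.subst σ) (ih₁ hσ)
      (ih₂ hσ)

theorem Typed.shiftT (h : Typed Γ Δ S C τ) (κ : Kind) :
    Typed (κ :: Γ) (Δ.map CTy.shift) S.shift C.shiftT τ.shift := by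
  rw [LCtx.shift_eq_tsubst, CTy.map_shift_eq_map_subst, CTy.shift_eq_subst]
  exact h.tsubst (.weaken Γ κ)

theorem Typed.tsubst_one {t : CTy 𝕃} (h : Typed (κ :: Γ) (Δ.map CTy.shift) S.shift C τ)
    (ht : Kinded Γ t κ) : Typed Γ Δ S (C.tsubst (CTy.one t)) (τ.subst (CTy.one t)) := by
  simpa only [CTy.map_shift_subst_one, LCtx.shift_tsubst_one] using h.tsubst (.one ht)

/-- `σ` replaces the local variables of `S` by local expressions that are well-typed in `S'`, at the
locations where the variable is bound. -/
def LocalSubst (Γ : List Kind) (S S' : LCtx 𝕃) (σ : ℕ → 𝕃.Expr) : Prop :=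
  ∀ x ρ t, S[x]? = some (ρ, t) → 𝕃.Typed (localKinds Γ) (S'.proj ρ) (σ x) t

theorem WF.typed_local_var {x : ℕ} (h : WF Γ Δ S) (hx : S.proj ρ x = some t) :
    𝕃.Typed (localKinds Γ) (S.proj ρ) (𝕃.var x) t :=
  𝕃.typed_var _ _ _ _ (fun _ _ => h.kinded_proj) hx

namespace LocalSubst

variable {σ : ℕ → 𝕃.Expr}

theorem shift (hσ : LocalSubst Γ S S' σ) (hS' : WF Γ Δ S') (κ : Kind) :
    LocalSubst (κ :: Γ) S.shift S'.shift fun n => shiftTyE (σ n) := by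
  intro x ρ t hx
  obtain ⟨⟨ρ, t⟩, hy, ⟨⟩⟩ := Option.map_eq_some_iff.1 (List.getElem?_map ▸ hx)
  have hσx := 𝕃.typed_instTy _ (localKinds (κ :: Γ)) _ (fun α => 𝕃.tvar (α + 1)) _ _ (hσ x ρ t hy)
    fun α hα => 𝕃.kinded_tvar _ _ hα
  refine 𝕃.typed_mono hσx (fun y s hy => ?_) fun _ _ => (hS'.shift κ).kinded_proj
  rw [LCtx.shift_eq_tsubst, CTy.shift_eq_subst]
  exact LCtx.proj_tsubst _ hy

theorem weaken (h : WF Γ Δ ((ρ, t) :: S)) :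
    LocalSubst Γ S ((ρ, t) :: S) fun n => 𝕃.var (n + 1) :=
  fun _ ρ' _ hx => h.typed_local_var (LCtx.proj_eq_some.2 ⟨ρ', hx, .refl _⟩)

theorem up (hσ : LocalSubst Γ S S' σ) (hS' : WF Γ Δ ((ρ, t) :: S')) :
    LocalSubst Γ ((ρ, t) :: S) ((ρ, t) :: S') (upE σ)
  | 0, ρ', _, hx => hS'.typed_local_var (LCtx.proj_eq_some.2 ⟨ρ', hx, .refl _⟩)
  | x + 1, ρ', t', hx =>
    𝕃.typed_subst _ _ _ _ _ _ (hσ x ρ' t' hx) (fun _ _ => hS'.kinded_proj) fun _ _ hy =>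
      hS'.typed_local_var (LCtx.proj_eq_some.2 (LCtx.proj_eq_some.1 hy))

theorem one (hS : WF Γ Δ S) (he : 𝕃.Typed (localKinds Γ) (S.proj ρ) e t) :
    LocalSubst Γ ((ρ, t) :: S) S (oneE e)
  | 0, _, _, rfl => he
  | _ + 1, ρ', _, hx => hS.typed_local_var (LCtx.proj_eq_some.2 ⟨ρ', hx, .refl _⟩)

end LocalSubst

theorem Typed.esubst {σ : ℕ → 𝕃.Expr} (h : Typed Γ Δ S C τ) (hS' : WF Γ Δ S')
    (hσ : LocalSubst Γ S S' σ) : Typed Γ Δ S' (C.esubst σ) τ := by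
  induction h generalizing S' σ with
  | var _ hn => exact .var hS' hn
  | comp _ hρ he =>
    refine .comp hS' hρ
      (𝕃.typed_subst _ _ _ _ _ _ he (fun _ _ => hS'.kinded_proj) fun x s hx => ?_)
    obtain ⟨ρ', hx, hs⟩ := LCtx.proj_eq_some.1 hx
    exact 𝕃.typed_mono (hσ x ρ' s hx) (fun _ _ => LCtx.proj_mono hs) fun _ _ => hS'.kinded_proj
  | fn h ih => exact .fn (ih (.add (.add hS' h.wf.tail.head) h.wf.head) hσ)
  | app _ _ ih₁ ih₂ => exact .app (ih₁ hS' hσ) (ih₂ hS' hσ)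
  | tabs _ ih => exact .tabs (ih (hS'.shift _) (hσ.shift hS' _))
  | tapp _ ht ih => exact .tapp (ih hS' hσ) ht
  | fold hk _ ih => exact .fold hk (ih hS' hσ)
  | unfold _ ih => exact .unfold (ih hS' hσ)
  | pair _ _ ih₁ ih₂ => exact .pair (ih₁ hS' hσ) (ih₂ hS' hσ)
  | fst _ ih => exact .fst (ih hS' hσ)
  | snd _ ih => exact .snd (ih hS' hσ)
  | inl _ hk ih => exact .inl (ih hS' hσ) hk
  | inr _ hk ih => exact .inr (ih hS' hσ) hk
  | caseOf _ h₁ h₂ ih ih₁ ih₂ =>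
    exact .caseOf (ih hS' hσ) (ih₁ (.add hS' h₁.wf.head) hσ) (ih₂ (.add hS' h₂.wf.head) hσ)
  | letE _ hs h₂ ih₁ ih₂ =>
    obtain ⟨hρ, ht⟩ := h₂.wf.localHead
    exact .letE (ih₁ hS' hσ) hs (ih₂ (hS'.addLocal hρ ht) (hσ.up (hS'.addLocal hρ ht)))
  | letLoc _ hs hA hk _ ih₁ ih₂ =>
    exact .letLoc (ih₁ hS' hσ) hs hA hk (ih₂ (hS'.shift _) (hσ.shift hS' _))
  | letLocSet _ hs hA hk _ ih₁ ih₂ =>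
    exact .letLocSet (ih₁ hS' hσ) hs hA hk (ih₂ (hS'.shift _) (hσ.shift hS' _))
  | letLocalTy _ hs hk _ ih₁ ih₂ =>
    exact .letLocalTy (ih₁ hS' hσ) hs hk (ih₂ (hS'.shift _) (hσ.shift hS' _))
  | send _ hn hk ih => exact .send (ih hS' hσ) hn hk
  | sync hl hk _ ih => exact .sync hl hk (ih hS' hσ)
  | ite _ hs _ _ ih ih₁ ih₂ => exact .ite (ih hS' hσ) hs (ih₁ hS' hσ) (ih₂ hS' hσ)

theorem Typed.shiftE (h : Typed Γ Δ S C τ) (hw : WF Γ Δ ((ρ, t) :: S)) :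
    Typed Γ Δ ((ρ, t) :: S) C.shiftE τ :=
  h.esubst hw (.weaken hw)

theorem Typed.rename {ξ : ℕ → ℕ} (h : Typed Γ Δ S C τ) (hw : WF Γ Δ' S) (hξ : Renames Δ Δ' ξ) :
    Typed Γ Δ' S (C.rename ξ) τ := by
  induction h generalizing Δ' ξ with
  | var _ hn => exact .var hw (hξ _ _ hn)
  | comp _ hρ he => exact .comp hw hρ he
  | fn h ih =>
    exact .fn (ih (.add (.add hw h.wf.tail.head) h.wf.head) ((hξ.upRen _).upRen _))
  | app _ _ ih₁ ih₂ => exact .app (ih₁ hw hξ) (ih₂ hw hξ)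
  | tabs _ ih => exact .tabs (ih (hw.shift _) (hξ.map _))
  | tapp _ ht ih => exact .tapp (ih hw hξ) ht
  | fold hk _ ih => exact .fold hk (ih hw hξ)
  | unfold _ ih => exact .unfold (ih hw hξ)
  | pair _ _ ih₁ ih₂ => exact .pair (ih₁ hw hξ) (ih₂ hw hξ)
  | fst _ ih => exact .fst (ih hw hξ)
  | snd _ ih => exact .snd (ih hw hξ)
  | inl _ hk ih => exact .inl (ih hw hξ) hk
  | inr _ hk ih => exact .inr (ih hw hξ) hk
  | caseOf _ h₁ h₂ ih ih₁ ih₂ =>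
    exact .caseOf (ih hw hξ) (ih₁ (.add hw h₁.wf.head) (hξ.upRen _))
      (ih₂ (.add hw h₂.wf.head) (hξ.upRen _))
  | letE _ hs h₂ ih₁ ih₂ =>
    obtain ⟨hρ, ht⟩ := h₂.wf.localHead
    exact .letE (ih₁ hw hξ) hs (ih₂ (.addLocal hw hρ ht) hξ)
  | letLoc _ hs hA hk _ ih₁ ih₂ =>
    exact .letLoc (ih₁ hw hξ) hs hA hk (ih₂ (hw.shift _) (hξ.map _))
  | letLocSet _ hs hA hk _ ih₁ ih₂ =>
    exact .letLocSet (ih₁ hw hξ) hs hA hk (ih₂ (hw.shift _) (hξ.map _))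
  | letLocalTy _ hs hk _ ih₁ ih₂ =>
    exact .letLocalTy (ih₁ hw hξ) hs hk (ih₂ (hw.shift _) (hξ.map _))
  | send _ hn hk ih => exact .send (ih hw hξ) hn hk
  | sync hl hk _ ih => exact .sync hl hk (ih hw hξ)
  | ite _ hs _ _ ih ih₁ ih₂ => exact .ite (ih hw hξ) hs (ih₁ hw hξ) (ih₂ hw hξ)

/-- `σ` replaces the choreographic variables of `Δ` by choreographies that are well-typed in
`Δ'`. -/
def ChorSubst (Γ : List Kind) (S : LCtx 𝕃) (Δ Δ' : List (CTy 𝕃)) (σ : ℕ → Chor 𝕃) : Prop :=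
  ∀ n τ, Δ[n]? = some τ → Typed Γ Δ' S (σ n) τ

namespace ChorSubst

variable {σ : ℕ → Chor 𝕃}

theorem shiftT (hσ : ChorSubst Γ S Δ Δ' σ) (κ : Kind) :
    ChorSubst (κ :: Γ) S.shift (Δ.map CTy.shift) (Δ'.map CTy.shift) fun n => (σ n).shiftT := by
  intro n τ h
  rw [List.getElem?_map, Option.map_eq_some_iff] at h
  obtain ⟨τ, h, rfl⟩ := h
  exact (hσ n τ h).shiftT κ

theorem shiftE (hσ : ChorSubst Γ S Δ Δ' σ) (hw : WF Γ Δ' ((ρ, t) :: S)) :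
    ChorSubst Γ ((ρ, t) :: S) Δ Δ' fun n => (σ n).shiftE :=
  fun n τ h => (hσ n τ h).shiftE hw

theorem up (hσ : ChorSubst Γ S Δ Δ' σ) (hw : WF Γ (τ :: Δ') S) :
    ChorSubst Γ S (τ :: Δ) (τ :: Δ') (Chor.up σ)
  | 0, _, hn => .var hw hn
  | n + 1, τ', hn => (hσ n τ' hn).rename hw (.succ Δ' τ)

theorem one (h : Typed Γ Δ S C τ) : ChorSubst Γ S (τ :: Δ) Δ (Chor.one C)
  | 0, _, rfl => h
  | _ + 1, _, hn => .var h.wf hn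

theorem two (h₀ : Typed Γ Δ S C₀ τ₀) (h₁ : Typed Γ Δ S C₁ τ₁) :
    ChorSubst Γ S (τ₀ :: τ₁ :: Δ) Δ (Chor.two C₀ C₁)
  | 0, _, rfl => h₀
  | 1, _, rfl => h₁
  | _ + 2, _, hn => .var h₀.wf hn

end ChorSubst

theorem Typed.subst {σ : ℕ → Chor 𝕃} (h : Typed Γ Δ S C τ) (hw : WF Γ Δ' S)
    (hσ : ChorSubst Γ S Δ Δ' σ) : Typed Γ Δ' S (C.subst σ) τ := by
  induction h generalizing Δ' σ with
  | var _ hn => exact hσ _ _ hn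
  | comp _ hρ he => exact .comp hw hρ he
  | fn h ih =>
    have hw₁ := hw.add h.wf.tail.head
    have hw₂ := hw₁.add h.wf.head
    exact .fn (ih hw₂ ((hσ.up hw₁).up hw₂))
  | app _ _ ih₁ ih₂ => exact .app (ih₁ hw hσ) (ih₂ hw hσ)
  | tabs _ ih => exact .tabs (ih (hw.shift _) (hσ.shiftT _))
  | tapp _ ht ih => exact .tapp (ih hw hσ) ht
  | fold hk _ ih => exact .fold hk (ih hw hσ)
  | unfold _ ih => exact .unfold (ih hw hσ)
  | pair _ _ ih₁ ih₂ => exact .pair (ih₁ hw hσ) (ih₂ hw hσ)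
  | fst _ ih => exact .fst (ih hw hσ)
  | snd _ ih => exact .snd (ih hw hσ)
  | inl _ hk ih => exact .inl (ih hw hσ) hk
  | inr _ hk ih => exact .inr (ih hw hσ) hk
  | caseOf _ h₁ h₂ ih ih₁ ih₂ =>
    have hw₁ := hw.add h₁.wf.head
    have hw₂ := hw.add h₂.wf.head
    exact .caseOf (ih hw hσ) (ih₁ hw₁ (hσ.up hw₁)) (ih₂ hw₂ (hσ.up hw₂))
  | letE _ hs h₂ ih₁ ih₂ =>
    obtain ⟨hρ, ht⟩ := h₂.wf.localHead
    exact .letE (ih₁ hw hσ) hs (ih₂ (hw.addLocal hρ ht) (hσ.shiftE (hw.addLocal hρ ht)))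
  | letLoc _ hs hA hk _ ih₁ ih₂ =>
    exact .letLoc (ih₁ hw hσ) hs hA hk (ih₂ (hw.shift _) (hσ.shiftT _))
  | letLocSet _ hs hA hk _ ih₁ ih₂ =>
    exact .letLocSet (ih₁ hw hσ) hs hA hk (ih₂ (hw.shift _) (hσ.shiftT _))
  | letLocalTy _ hs hk _ ih₁ ih₂ =>
    exact .letLocalTy (ih₁ hw hσ) hs hk (ih₂ (hw.shift _) (hσ.shiftT _))
  | send _ hn hk ih => exact .send (ih hw hσ) hn hk
  | sync hl hk _ ih => exact .sync hl hk (ih hw hσ)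
  | ite _ hs _ _ ih ih₁ ih₂ => exact .ite (ih hw hσ) hs (ih₁ hw hσ) (ih₂ hw hσ)

end Substitution

/-! ### Preservation -/

section Preservation

variable {Γ : List Kind} {Δ : List (CTy 𝕃)} {S : LCtx 𝕃} {C C' C₁ C₂ : Chor 𝕃}
  {l ρ ρ' ρ₁ ρ₂ τ t' : CTy 𝕃} {t : 𝕃.Ty} {e v : 𝕃.Expr} {κ : Kind} {P : Set (CTy 𝕃)}

/-- `LetTy ρ κ t`: the values of the local type `t` represent types of kind `κ`, so that
`let ρ.α :: κ := C₁ in C₂` may bind `α` to the result of a `C₁` of type `t`; a location or location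
set represented by such a value is contained in `ρ`. -/
inductive LetTy (ρ : CTy 𝕃) : Kind → 𝕃.Ty → Prop
  | loc {A} : SubLoc (.ofFinset A) ρ → LetTy ρ .loc (𝕃.locTy A)
  | locSet {A} : SubLoc (.ofFinset A) ρ → LetTy ρ .locSet (𝕃.locSetTy A)
  | lty : LetTy ρ .lty 𝕃.repTy

theorem typed_letT_iff : Typed Γ Δ S (.letT ρ κ C₁ C₂) τ ↔
    ∃ t ρ', LetTy ρ κ t ∧ Typed Γ Δ S C₁ (.located t ρ') ∧ SubLoc ρ ρ' ∧ Kinded Γ τ .chor ∧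
      Typed (κ :: Γ) (Δ.map CTy.shift) S.shift C₂ τ.shift := by
  constructor
  · intro
    | .letLoc h₁ hs hA hk h₂ => exact ⟨_, _, .loc hA, h₁, hs, hk, h₂⟩
    | .letLocSet h₁ hs hA hk h₂ => exact ⟨_, _, .locSet hA, h₁, hs, hk, h₂⟩
    | .letLocalTy h₁ hs hk h₂ => exact ⟨_, _, .lty, h₁, hs, hk, h₂⟩
  · rintro ⟨_, _, hA | hA | _, h₁, hs, hk, h₂⟩
    · exact .letLoc h₁ hs hA hk h₂
    · exact .letLocSet h₁ hs hA hk h₂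
    · exact .letLocalTy h₁ hs hk h₂

theorem LetTy.kinded_of_resolve {S : ℕ → Option 𝕃.Ty} (ht : LetTy ρ κ t) (hv : 𝕃.IsVal v)
    (h : 𝕃.Typed (localKinds Γ) S v t) (hr : resolve 𝕃 κ v = some t') : Kinded Γ t' κ := by
  cases ht with
  | loc =>
    obtain ⟨L, -, rfl⟩ := Option.map_eq_some_iff.1 hr
    exact .loc L
  | locSet =>
    obtain ⟨A, -, rfl⟩ := Option.map_eq_some_iff.1 hr
    exact .ofFinset Γ A
  | lty =>
    obtain ⟨s, hs, rfl⟩ := Option.map_eq_some_iff.1 hr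
    exact .lty (𝕃.rep_kinded _ _ _ _ hv h hs)

theorem Redex.rloc_exitE (k : ℕ) (R : Redex 𝕃) : (R.exitE k).rloc = R.rloc := by
  unfold Redex.exitE
  induction R <;> simp_all [Redex.map, Redex.rloc]

theorem Redex.rloc_exitT (k : ℕ) (R : Redex 𝕃) : (R.exitT k).rloc = R.rloc := by
  have poss_sng_rename (l : CTy 𝕃) : poss (.sng (l.rename (exitScope k))) = poss (.sng l) :=
    poss_rename _ (.sng l)
  unfold Redex.exitT
  induction R <;> simp_all [Redex.map, Redex.rloc, poss_rename]

theorem EvalCtx.rloc_redex (η : EvalCtx 𝕃) (R : Redex 𝕃) : (η.redex R).rloc = R.rloc := by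
  cases η <;> rfl

/-- No location of `P` possibly binds a variable of `S`. -/
def LCtx.Avoids (S : LCtx 𝕃) (P : Set (CTy 𝕃)) : Prop :=
  ∀ p ∈ S, Disjoint P (poss p.1)

namespace LCtx.Avoids

theorem nil (P : Set (CTy 𝕃)) : LCtx.Avoids [] P :=
  nofun

theorem cons (h : S.Avoids P) (hρ : Disjoint P (poss ρ)) : LCtx.Avoids ((ρ, t) :: S) P :=
  List.forall_mem_cons.2 ⟨hρ, h⟩

theorem shift (h : S.Avoids P) : S.shift.Avoids P := by
  intro p hp
  obtain ⟨q, hq, rfl⟩ := List.mem_map.1 hp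
  exact (poss_rename Nat.succ q.1).symm ▸ h q hq

theorem proj_eq_none (h : S.Avoids P) (hlP : l ∈ P) (hl : Kinded Γ l .loc) (hn : Nec l ρ) :
    S.proj ρ = fun _ => none := by
  funext x
  refine Option.eq_none_iff_forall_ne_some.2 fun t hx => ?_
  obtain ⟨ρ', hx, hs⟩ := LCtx.proj_eq_some.1 hx
  exact Set.disjoint_left.1 (h _ (List.mem_of_getElem? hx)) hlP ((hn.mono hs).poss hl)

end LCtx.Avoids

theorem Typed.fill_of_forall {η : EvalCtx 𝕃} (h : Typed Γ Δ S (η.fill C) τ)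
    (hC : ∀ {τ}, Typed Γ Δ S C τ → Typed Γ Δ S C' τ) : Typed Γ Δ S (η.fill C') τ := by
  cases η with
  | appL => let .app h₁ h₂ := h; exact .app (hC h₁) h₂
  | appR => let .app h₁ h₂ := h; exact .app h₁ (hC h₂)
  | tapp => let .tapp h hk := h; exact .tapp (hC h) hk
  | fold => let .fold hk h := h; exact .fold hk (hC h)
  | unfold => let .unfold h := h; exact .unfold (hC h)
  | pairL => let .pair h₁ h₂ := h; exact .pair (hC h₁) h₂
  | pairR => let .pair h₁ h₂ := h; exact .pair h₁ (hC h₂)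
  | fst => let .fst h := h; exact .fst (hC h)
  | snd => let .snd h := h; exact .snd (hC h)
  | inl => let .inl h hk := h; exact .inl (hC h) hk
  | inr => let .inr h hk := h; exact .inr (hC h) hk
  | caseOf => let .caseOf h h₁ h₂ := h; exact .caseOf (hC h) h₁ h₂
  | letE => let .letE h hs h₂ := h; exact .letE (hC h) hs h₂
  | letT =>
    obtain ⟨t, ρ', ht, h₁, h₂⟩ := typed_letT_iff.1 h
    exact typed_letT_iff.2 ⟨t, ρ', ht, hC h₁, h₂⟩
  | send => let .send h hn hk := h; exact .send (hC h) hn hk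
  | ite => let .ite h hs h₁ h₂ := h; exact .ite (hC h) hs h₁ h₂

theorem Typed.letE_comp (h : Typed Γ Δ S (.letE ρ t (.comp ρ' e) C) τ) :
    Typed Γ Δ S (C.esubst (oneE e)) τ := by
  let .letE (.comp hw _ he) hs hC := h
  exact hC.esubst hw
    (.one hw (𝕃.typed_mono he (fun _ _ => LCtx.proj_mono hs) fun _ _ => hw.kinded_proj))

theorem Typed.letT_comp (h : Typed Γ Δ S (.letT ρ κ (.comp ρ' v) C) τ) (hv : 𝕃.IsVal v)
    (hr : resolve 𝕃 κ v = some t') : Typed Γ Δ S (C.tsubst (CTy.one t')) τ := by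
  obtain ⟨t, ρ'', ht, h₁, -, -, hC⟩ := typed_letT_iff.1 h
  let .comp _ _ h := h₁
  exact CTy.shift_subst_one t' τ ▸ hC.tsubst_one (ht.kinded_of_resolve hv h hr)

theorem Typed.send_comp (h : Typed Γ Δ S (.send (.comp ρ₁ v) l ρ₂) τ) (hv : 𝕃.IsVal v)
    (ha : S.Avoids (poss (.sng l) ∪ poss ρ₂) ∨ 𝕃.ValuesClosed) :
    Typed Γ Δ S (.comp (.union ρ₁ ρ₂) v) τ := by
  let .send (.comp hw hρ₁ h) hn hρ₂ := h
  suffices h_closed : 𝕃.Typed (localKinds Γ) (fun _ => none) v _ from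
    .comp hw (.union hρ₁ hρ₂) (𝕃.typed_mono h_closed nofun fun _ _ => hw.kinded_proj)
  rcases ha with ha | hc
  · have hl := hn.kinded hρ₁
    exact ha.proj_eq_none (.inl ((Nec.sng l).poss hl)) hl hn ▸ h
  · exact hc _ _ _ _ hv h

theorem Typed.preservation {R : Redex 𝕃} (hpres : 𝕃.Preservation) (h : Typed Γ Δ S C τ)
    (hC : Step C R C') (ha : S.Avoids R.rloc ∨ 𝕃.ValuesClosed) : Typed Γ Δ S C' τ := by
  induction hC generalizing Γ Δ S τ with
  | ctx η _ ih => exact h.fill_of_forall fun h => ih h (η.rloc_redex _ ▸ ha)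
  | comp he => let .comp hw hρ h := h; exact .comp hw hρ (hpres _ _ _ _ _ h he)
  | app => let .app (.fn hC) hV := h; exact hC.subst hV.wf (.two hV (.fn hC))
  | tapp => let .tapp (.tabs hC) ht := h; exact hC.tsubst_one ht
  | unfoldFold => let .unfold (.fold _ h) := h; exact h
  | fstPair => let .fst (.pair h _) := h; exact h
  | sndPair => let .snd (.pair _ h) := h; exact h
  | caseInl => let .caseOf (.inl hV _) h₁ _ := h; exact h₁.subst hV.wf (.one hV)
  | caseInr => let .caseOf (.inr hV _) _ h₂ := h; exact h₂.subst hV.wf (.one hV)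
  | letEV => exact h.letE_comp
  | letEI k _ hd ih =>
    rw [Redex.rloc_exitE] at hd ha
    let .letE h₁ hs h₂ := h
    exact .letE h₁ hs (ih h₂ (ha.imp_left (·.cons (hd.mono_right Set.subset_union_left))))
  | letTV hv hr => exact h.letT_comp hv hr
  | letTI k _ _ ih =>
    rw [Redex.rloc_exitT] at ha
    obtain ⟨t, ρ', ht, h₁, hs, hk, h₂⟩ := typed_letT_iff.1 h
    exact typed_letT_iff.2 ⟨t, ρ', ht, h₁, hs, hk, ih h₂ (ha.imp_left (·.shift))⟩
  | sendV hv => exact h.send_comp hv ha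
  | sync => let .sync _ _ h := h; exact h
  | syncI _ _ ih => let .sync hl hρ h := h; exact .sync hl hρ (ih h ha)
  | ifT => let .ite _ _ h₁ _ := h; exact h₁
  | ifF => let .ite _ _ _ h₂ := h; exact h₂
  | ifI _ _ _ ih₁ ih₂ => let .ite h hs h₁ h₂ := h; exact .ite h hs (ih₁ h₁ ha) (ih₂ h₂ ha)
  | appI _ _ ih => let .app h₁ h₂ := h; exact .app h₁ (ih h₂ ha)
  | pairI _ _ ih => let .pair h₁ h₂ := h; exact .pair h₁ (ih h₂ ha)

end Preservation

/-! ### Progress -/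

section Progress

variable {Γ : List Kind} {Δ : List (CTy 𝕃)} {S : LCtx 𝕃} {C C₁ C₂ : Chor 𝕃}
  {l ρ ρ' τ τ₁ τ₂ : CTy 𝕃} {t : 𝕃.Ty} {v : 𝕃.Expr} {κ : Kind}

theorem LetTy.exists_resolve_eq_some (ht : LetTy ρ κ t) (hv : 𝕃.IsVal v)
    (h : 𝕃.Typed ∅ (fun _ => none) v t) : ∃ t', resolve 𝕃 κ v = some t' := by
  cases ht with
  | loc =>
    obtain ⟨L, -, hL⟩ := 𝕃.val_loc v _ hv h
    exact ⟨.loc L, congrArg (Option.map CTy.loc) hL⟩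
  | locSet =>
    obtain ⟨A, -, hA⟩ := 𝕃.val_locSet v _ hv h
    exact ⟨.ofFinset A, congrArg (Option.map CTy.ofFinset) hA⟩
  | lty =>
    obtain ⟨s, hs⟩ := 𝕃.val_rep v hv h
    exact ⟨.lty s, congrArg (Option.map CTy.lty) hs⟩

theorem Typed.eq_comp_of_isVal (h : Typed Γ Δ S C (.located t ρ)) (hv : C.IsVal) :
    ∃ v, C = .comp ρ v ∧ 𝕃.IsVal v ∧ 𝕃.Typed (localKinds Γ) (S.proj ρ) v t := by
  cases hv with
  | comp hv => let .comp _ _ h := h; exact ⟨_, rfl, hv, h⟩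
  | _ => cases h

/-- `C` is not stuck: it is a value or performs a step. -/
def Chor.Progresses (C : Chor 𝕃) : Prop :=
  C.IsVal ∨ ∃ R C', Step C R C'

theorem Step.progresses {R : Redex 𝕃} {C' : Chor 𝕃} (h : Step C R C') : C.Progresses :=
  .inr ⟨R, C', h⟩

theorem Chor.Progresses.fill (η : EvalCtx 𝕃) (h : C.Progresses)
    (hv : C.IsVal → (η.fill C).Progresses) : (η.fill C).Progresses := by
  rcases h with h | ⟨R, C', h⟩
  · exact hv h
  · exact (Step.ctx η h).progresses

theorem localKinds_nil : localKinds [] = ∅ :=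
  Set.eq_empty_of_forall_notMem nofun

namespace Typed

theorem progresses_app (h₁ : Typed Γ Δ S C₁ (.arr τ₁ τ₂)) (hC₁ : C₁.Progresses)
    (hC₂ : C₂.Progresses) : (Chor.app C₁ C₂).Progresses := by
  refine hC₁.fill (.appL C₂) fun hv₁ => hC₂.fill (.appR C₁ hv₁) fun hv₂ => ?_
  cases hv₁ with
  | fn => exact (Step.app hv₂).progresses
  | _ => cases h₁

theorem progresses_tapp {t : CTy 𝕃} (h : Typed Γ Δ S C (.all κ τ)) (hC : C.Progresses) :
    (Chor.tapp C t).Progresses := by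
  refine hC.fill (.tapp t) fun hv => ?_
  cases hv with
  | tabs => exact Step.tapp.progresses
  | _ => cases h

theorem progresses_unfold (h : Typed Γ Δ S C (.mu τ)) (hC : C.Progresses) :
    (Chor.unfold C).Progresses := by
  refine hC.fill .unfold fun hv => ?_
  cases hv with
  | fold hv => exact (Step.unfoldFold hv).progresses
  | _ => cases h

theorem progresses_fst (h : Typed Γ Δ S C (.prod τ₁ τ₂)) (hC : C.Progresses) :
    (Chor.fst C).Progresses := by
  refine hC.fill .fst fun hv => ?_
  cases hv with
  | pair hv₁ hv₂ => exact (Step.fstPair hv₁ hv₂).progresses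
  | _ => cases h

theorem progresses_snd (h : Typed Γ Δ S C (.prod τ₁ τ₂)) (hC : C.Progresses) :
    (Chor.snd C).Progresses := by
  refine hC.fill .snd fun hv => ?_
  cases hv with
  | pair hv₁ hv₂ => exact (Step.sndPair hv₁ hv₂).progresses
  | _ => cases h

theorem progresses_caseOf (h : Typed Γ Δ S C (.sum τ₁ τ₂)) (hC : C.Progresses) :
    (Chor.caseOf C C₁ C₂).Progresses := by
  refine hC.fill (.caseOf C₁ C₂) fun hv => ?_
  cases hv with
  | inl hv => exact (Step.caseInl hv).progresses
  | inr hv => exact (Step.caseInr hv).progresses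
  | _ => cases h

theorem progresses_letE (h : Typed Γ Δ S C₁ (.located t ρ')) (hC₁ : C₁.Progresses) :
    (Chor.letE ρ t C₁ C₂).Progresses := by
  refine hC₁.fill (.letE ρ t C₂) fun hv => ?_
  obtain ⟨v, rfl, hv, -⟩ := h.eq_comp_of_isVal hv
  exact (Step.letEV hv).progresses

theorem progresses_letT (hΓ : localKinds Γ = ∅) (ht : LetTy ρ κ t)
    (h : Typed Γ Δ [] C₁ (.located t ρ')) (hC₁ : C₁.Progresses) :
    (Chor.letT ρ κ C₁ C₂).Progresses := by
  refine hC₁.fill (.letT ρ κ C₂) fun hv => ?_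
  obtain ⟨v, rfl, hv, h⟩ := h.eq_comp_of_isVal hv
  obtain ⟨t', hr⟩ := ht.exists_resolve_eq_some hv (hΓ ▸ h)
  exact (Step.letTV hv hr).progresses

theorem progresses_send (h : Typed Γ Δ S C (.located t ρ)) (hC : C.Progresses) :
    (Chor.send C l ρ').Progresses := by
  refine hC.fill (.send l ρ') fun hv => ?_
  obtain ⟨v, rfl, hv, -⟩ := h.eq_comp_of_isVal hv
  exact (Step.sendV hv).progresses

theorem progresses_ite (hΓ : localKinds Γ = ∅) (h : Typed Γ Δ [] C (.located 𝕃.boolTy ρ'))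
    (hC : C.Progresses) : (Chor.ite ρ C C₁ C₂).Progresses := by
  refine hC.fill (.ite ρ C₁ C₂) fun hv => ?_
  obtain ⟨v, rfl, hv, h⟩ := h.eq_comp_of_isVal hv
  obtain ⟨_ | _, hb⟩ := 𝕃.val_bool v hv (hΓ ▸ h)
  · exact (Step.ifF hv hb).progresses
  · exact (Step.ifT hv hb).progresses

theorem progresses_comp (hprog : 𝕃.Progress) {e : 𝕃.Expr}
    (h : 𝕃.Typed ∅ (fun _ => none) e t) : (Chor.comp ρ e).Progresses := by
  rcases hprog e t h with hv | ⟨e', h⟩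
  · exact .inl (.comp hv)
  · exact (Step.comp h).progresses

theorem progress (hprog : 𝕃.Progress) (hΓ : localKinds Γ = ∅) (h : Typed Γ [] [] C τ) :
    C.Progresses := by
  induction C generalizing τ with
  | var => let .var _ hn := h; cases hn
  | comp => let .comp _ _ h := h; exact progresses_comp hprog (hΓ ▸ h)
  | fn => exact .inl .fn
  | app _ _ ih₁ ih₂ => let .app h₁ h₂ := h; exact h₁.progresses_app (ih₁ h₁) (ih₂ h₂)
  | tabs => exact .inl .tabs
  | tapp _ _ ih => let .tapp h _ := h; exact h.progresses_tapp (ih h)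
  | fold _ ih => let .fold _ h := h; exact (ih h).fill .fold fun hv => .inl hv.fold
  | unfold _ ih => let .unfold h := h; exact h.progresses_unfold (ih h)
  | pair _ _ ih₁ ih₂ =>
    let .pair h₁ h₂ := h
    exact (ih₁ h₁).fill (.pairL _) fun hv₁ => (ih₂ h₂).fill (.pairR _ hv₁) fun hv₂ =>
      .inl (hv₁.pair hv₂)
  | fst _ ih => let .fst h := h; exact h.progresses_fst (ih h)
  | snd _ ih => let .snd h := h; exact h.progresses_snd (ih h)
  | inl _ ih => let .inl h _ := h; exact (ih h).fill .inl fun hv => .inl hv.inl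
  | inr _ ih => let .inr h _ := h; exact (ih h).fill .inr fun hv => .inl hv.inr
  | caseOf _ _ _ ih => let .caseOf h _ _ := h; exact h.progresses_caseOf (ih h)
  | letE _ _ _ _ ih => let .letE h _ _ := h; exact h.progresses_letE (ih h)
  | letT _ _ _ _ ih =>
    obtain ⟨t, ρ', ht, h, -⟩ := typed_letT_iff.1 h
    exact h.progresses_letT hΓ ht (ih h)
  | send _ _ _ ih => let .send h _ _ := h; exact h.progresses_send (ih h)
  | sync => exact Step.sync.progresses
  | ite _ _ _ _ ih => let .ite h _ _ _ := h; exact h.progresses_ite hΓ (ih h)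

end Typed

end Progress

end LambdaQC

open LambdaQC in
theorem mainTheorem4_general {Loc : Type u} (𝕃 : LocalLang.{u, v, w} Loc)
    (hprog : 𝕃.Progress) (hpres : 𝕃.Preservation) :
    (∀ (Γ : List Kind) (Δ : List (CTy 𝕃)) (S : LCtx 𝕃) (C C' : Chor 𝕃) (τ : CTy 𝕃) (R : Redex 𝕃),
      (S.Avoids R.rloc ∨ 𝕃.ValuesClosed) → Typed Γ Δ S C τ → Step C R C' → Typed Γ Δ S C' τ) ∧
    (∀ (Γ : List Kind) (C : Chor 𝕃) (τ : CTy 𝕃), localKinds Γ = ∅ → Typed Γ [] [] C τ →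
      C.IsVal ∨ ∃ R C', Step C R C') :=
  ⟨fun _ _ _ _ _ _ _ ha h hC => h.preservation hpres hC ha, fun _ _ _ hΓ h => h.progress hprog hΓ⟩

open LambdaQC in
/-- Type soundness: preservation, in contexts without local variables and, if local values are
closed, in all contexts; and progress. -/
theorem mainTheorem4 {Loc : Type u} (𝕃 : LocalLang.{u, v, w} Loc)
    (hprog : 𝕃.Progress) (hpres : 𝕃.Preservation) :
    (∀ (Γ : List Kind) (Δ : List (CTy 𝕃)) (S : LCtx 𝕃) (C C' : Chor 𝕃) (τ : CTy 𝕃) (R : Redex 𝕃),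
      (S = [] ∨ 𝕃.ValuesClosed) → Typed Γ Δ S C τ → Step C R C' → Typed Γ Δ S C' τ) ∧
    (∀ (C : Chor 𝕃) (τ : CTy 𝕃), Typed [] [] [] C τ → C.IsVal ∨ ∃ R C', Step C R C') :=
  let ⟨preservation, progress⟩ := mainTheorem4_general 𝕃 hprog hpres
  ⟨fun _ _ _ _ _ _ R hS => preservation _ _ _ _ _ _ R
      (hS.imp_left fun h => by rw [h]; exact .nil R.rloc),
    fun _ _ => progress _ _ _ localKinds_nil⟩
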